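/- **Conventions.** A smooth potential on $\mathbb R^N$ is a continuous function $V:\mathbb R^N\to(-\infty,+\infty]$ that is $C^\infty$ on the open set $\{V<\infty\}$. Put $\Sigma_v=V^{-1}(v)$, let $d\sigma$ be the $(N-1)$-dimensional surface (normalised Hausdorff) measure, and let $\Omega(v,N)=\int_{\Sigma_v}\frac{d\sigma}{\|\nabla V\|}$ be the structure integral. Two subsets $A,B$ of Euclidean spaces are diffeomorphic ($A\approx B$) if there is a bijection $A\to B$ such that it and its inverse are locally restrictions of $C^\infty$ maps. A function is Morse on a set if each of its critical points in that set has nondegenerate Hessian. **(1) Fluid potentials.** Let $N=nd\ge 2$ and let $$V_N(q)=\sum_{i\ne j=1}^n\Psi(\|\vec q_i-\vec q_j\|)+\sum_{i=1}^nU_\Lambda(\vec q_i),\qquad \vec q_i\in\mathbb R^d,$$ be a smooth potential, where $\Psi$ is a function of one variable with values in $[-\infty,+\infty]$ and $U_\Lambda$ is a smooth potential on $\mathbb R^d$ which vanishes on a set $\Lambda'\subset\Lambda$ and equals $+\infty$ outside $\Lambda$, with $\Lambda\subset\mathbb R^d$ closed and bounded. Suppose that $V_N$ is Morse on $\{v_0\le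 V_N\le v_1\}$ and that $\Sigma_v\approx\Sigma_{v'}$ for all $v,v'\in[v_0,v_1]$. Then the integral $\Omega(v,N)$ converges for all $v\in(v_0,v_1)$, and $v\mapsto\Omega(v,N)$ is $C^\infty$ on $(v_0,v_1)$. **(2) Lattice potentials.** The same conclusion holds if $I\subset\mathbb N^d$ is a finite set of sites, $N=|I|D\ge2$, and $$V_N(q)=\sum_{i,j\in I}C_{ij}\Psi(\|\vec q_i-\vec q_j\|)+\sum_{i\in I}\Phi(\vec q_i),\qquad \vec q_i\in\mathbb R^D,\ C_{ij}\in\mathbb R,$$ is a smooth potential ($\Psi,\Phi$ with values in $[-\infty,+\infty]$, $0\cdot(\pm\infty)=0$ and $(+\infty)+(-\infty)=-\infty$) which is confining: for every $E\in\mathbb R$ there is a compact $K\subset\mathbb R^D$ such that $V_N(q)\le E$ implies $\vec q_i\in K$ for all $i$; again $V_N$ is assumed Morse on $\{v_0\le V_N\le v_1\}$ and $\Sigma_v\approx\Sigma_{v'}$ for all $v,v'\in[v_0,v_1]$. In particular, (1) and (2) apply to standard, smooth, confining, short-range, stable potentials which are Morse functions. **(3)** Let $N\ge2$, let $U\subset\mathbb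 R^N$ be open and bounded, let $\psi\in C^\infty(U)$ be real valued and Morse on $\{x\in U: v_0\le\psi(x)\le v_1\}$, and put $\Sigma_v=\{x\in U:\psi(x)=v\}$. If $\Sigma_v$ is compact for every $v\in[v_0,v_1]$ and $\Sigma_v\approx\Sigma_{v'}$ for all $v,v'\in[v_0,v_1]$, then for every $g\in C^\infty(U)$ the integral $\int_{\Sigma_v}g\,d\sigma$ converges for all $v\in(v_0,v_1)$ and is a $C^\infty$ function of $v$ on $(v_0,v_1)$. **(4)** Let $N\ge1$, let $U\subset\mathbb R^N$ be open and bounded, let $\psi\in C^\infty(U)$ be real valued, and put $\Sigma_v=\{x\in U:\psi(x)=v\}$. If $\{x\in U: a\le\psi(x)\le b\}$ is compact for all $a,b$ with $v_0<a$ and $b<v_1$, and if there is $C>0$ with $\|\nabla\psi(x)\|\ge C$ for all $x\in U$ with $v_0<\psi(x)<v_1$, then for every $g\in C^\infty(U)$ the integral $\int_{\Sigma_v}g\,d\sigma$ converges for all $v\in(v_0,v_1)$ and is a $C^\infty$ function of $v$ on $(v_0,v_1)$. -/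

import Mathlib

open MeasureTheory Set
open scoped ContDiff

namespace StructureIntegral

/-- A map between subsets of Euclidean spaces is smooth on an arbitrary subset `A` if near every
point of `A` it agrees on `A` with a `C^∞` map defined on an open set. -/
def SmoothOnSubset {E F : Type*} [NormedAddCommGroup E] [NormedSpace ℝ E]
    [NormedAddCommGroup F] [NormedSpace ℝ F] (f : E → F) (A : Set E) : Prop :=
  ∀ x ∈ A, ∃ (O : Set E) (g : E → F), IsOpen O ∧ x ∈ O ∧ ContDiffOn ℝ ∞ g O ∧ EqOn f g (A ∩ O)

/-- `C^∞`-diffeomorphic subsets of Euclidean spaces: there is a smooth bijection with smooth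
inverse.  (For embedded submanifolds this is the usual notion.) -/
def DiffeomorphicSubsets {E F : Type*} [NormedAddCommGroup E] [NormedSpace ℝ E]
    [NormedAddCommGroup F] [NormedSpace ℝ F] (A : Set E) (B : Set F) : Prop :=
  ∃ (f : E → F) (h : F → E), SmoothOnSubset f A ∧ SmoothOnSubset h B ∧
    MapsTo f A B ∧ MapsTo h B A ∧ LeftInvOn h f A ∧ RightInvOn h f B

/-- `f` is a Morse function on `S`: at each critical point of `f` lying in `S` the Hessian of `f`
is a nondegenerate bilinear form. -/
def MorseOn {E : Type*} [NormedAddCommGroup E] [NormedSpace ℝ E] (f : E → ℝ) (S : Set E) : Prop :=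
  ∀ x ∈ S, fderiv ℝ f x = 0 → ∀ u : E, (∀ w : E, fderiv ℝ (fderiv ℝ f) x u w = 0) → u = 0

/-- The surface element `dσ` of hypersurfaces of the Euclidean space `ℝ^κ`: the
`(N - 1)`-dimensional Hausdorff measure, `N` being the number of coordinates, normalised so as to
agree with Lebesgue measure on `(N - 1)`-dimensional Euclidean space. -/
noncomputable def surfaceMeasure (κ : Type*) [Fintype κ] : Measure (EuclideanSpace ℝ κ) :=
  Measure.euclideanHausdorffMeasure (Fintype.card κ - 1)

/-- A smooth potential with values in `(-∞, +∞]`: it never takes the value `-∞`, it is continuous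
as an extended-real-valued function (hence finite on an open set, and it tends to `+∞` when its
domain of finiteness is left), and it is `C^∞` where it is finite.  An everywhere finite potential
is smooth in this sense iff it is `C^∞`. -/
structure IsSmoothPotential {E : Type*} [NormedAddCommGroup E] [NormedSpace ℝ E]
    (V : E → EReal) : Prop where
  ne_bot : ∀ q, V q ≠ ⊥
  continuous : Continuous V
  contDiffOn : ContDiffOn ℝ ∞ (fun q => (V q).toReal) {q | V q ≠ ⊤}

/-- The equipotential set `Σ_v = V⁻¹(v)`. -/
def equipotential {E : Type*} (V : E → EReal) (v : ℝ) : Set E :=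
  {q | V q = (v : EReal)}

/-- The integrand `1 / ‖∇V‖` of the structure integral. -/
noncomputable def structureDensity {κ : Type*} [Fintype κ] (V : EuclideanSpace ℝ κ → EReal)
    (q : EuclideanSpace ℝ κ) : ℝ :=
  1 / ‖gradient (fun p => (V p).toReal) q‖

/-- The structure integral `Ω(v, N) = ∫_{Σ_v} dσ / ‖∇V‖`. -/
noncomputable def structureIntegral {κ : Type*} [Fintype κ] (V : EuclideanSpace ℝ κ → EReal)
    (v : ℝ) : ℝ :=
  ∫ q in equipotential V v, structureDensity V q ∂(surfaceMeasure κ)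

/-- The vector `q_i ∈ ℝ^D` of the degrees of freedom of the particle (or site) `i`, for a
configuration `q`. -/
def position {ι : Type*} {D : ℕ} (q : EuclideanSpace ℝ (ι × Fin D)) (i : ι) :
    EuclideanSpace ℝ (Fin D) :=
  WithLp.toLp 2 fun a => q (i, a)

/-- A smoothed potential barrier confining particles to the closed and bounded region `Λ`:
it vanishes on `Λ' ⊆ Λ`, equals `+∞` off `Λ`, and passes smoothly from `0` to `+∞` in between. -/
structure IsSmoothBarrier {d : ℕ} (Λ Λ' : Set (EuclideanSpace ℝ (Fin d)))
    (U : EuclideanSpace ℝ (Fin d) → EReal) : Prop where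
  isCompact : IsCompact Λ
  subset : Λ' ⊆ Λ
  eq_zero : ∀ x ∈ Λ', U x = 0
  eq_top : ∀ x ∈ Λᶜ, U x = ⊤
  smooth : IsSmoothPotential U

/-- The potential `∑_{i ≠ j} Ψ(‖q_i - q_j‖) + ∑_i U(q_i)` of a fluid of `n` particles in `ℝ^d`. -/
noncomputable def fluidPotential (n d : ℕ) (Ψ : ℝ → EReal) (U : EuclideanSpace ℝ (Fin d) → EReal)
    (q : EuclideanSpace ℝ (Fin n × Fin d)) : EReal :=
  (∑ p ∈ (Finset.univ : Finset (Fin n)).offDiag, Ψ ‖position q p.1 - position q p.2‖)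
    + ∑ i, U (position q i)

/-- The potential `∑_{i, j ∈ I} C_{ij} Ψ(‖q_i - q_j‖) + ∑_{i ∈ I} Φ(q_i)` of a system on the finite
set of lattice sites `I ⊆ ℕ^d`, with `D` degrees of freedom on each site. -/
noncomputable def latticePotential {d : ℕ} (I : Finset (Fin d → ℕ)) (D : ℕ)
    (C : (Fin d → ℕ) → (Fin d → ℕ) → ℝ) (Ψ : ℝ → EReal)
    (Φ : EuclideanSpace ℝ (Fin D) → EReal) (q : EuclideanSpace ℝ (I × Fin D)) : EReal :=
  (∑ i : I, ∑ j : I, (C i j : EReal) * Ψ ‖position q i - position q j‖)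
    + ∑ i : I, Φ (position q i)

/-- A confining lattice potential: at finite energy the vectors `q_i` are constrained to a compact
set of values. -/
def ConfinesSites {ι : Type*} {D : ℕ} (V : EuclideanSpace ℝ (ι × Fin D) → EReal) : Prop :=
  ∀ E : ℝ, ∃ K : Set (EuclideanSpace ℝ (Fin D)), IsCompact K ∧
    ∀ q, V q ≤ (E : EReal) → ∀ i, position q i ∈ K

/-- The structure integral of `V` is a convergent integral for every `v ∈ (v₀, v₁)` and a `C^∞`
function of `v` on that interval. -/
def SmoothStructureIntegral {κ : Type*} [Fintype κ] (V : EuclideanSpace ℝ κ → EReal)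
    (v₀ v₁ : ℝ) : Prop :=
  (∀ v ∈ Ioo v₀ v₁, IntegrableOn (structureDensity V) (equipotential V v) (surfaceMeasure κ)) ∧
    ContDiffOn ℝ ∞ (structureIntegral V) (Ioo v₀ v₁)

/-- The level set `{x ∈ U | ψ x = v}`. -/
def levelSet {E : Type*} (U : Set E) (ψ : E → ℝ) (v : ℝ) : Set E :=
  {x ∈ U | ψ x = v}

/-- For every `v ∈ (v₀, v₁)` the integral `∫_{Σ_v} g dσ` over the level set
`Σ_v = {x ∈ U | ψ x = v}` converges, and it is a `C^∞` function of `v` on that interval. -/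
def SmoothLevelIntegral {κ : Type*} [Fintype κ] (U : Set (EuclideanSpace ℝ κ))
    (ψ g : EuclideanSpace ℝ κ → ℝ) (v₀ v₁ : ℝ) : Prop :=
  (∀ v ∈ Ioo v₀ v₁, IntegrableOn g (levelSet U ψ v) (surfaceMeasure κ)) ∧
    ContDiffOn ℝ ∞ (fun v => ∫ x in levelSet U ψ v, g x ∂(surfaceMeasure κ)) (Ioo v₀ v₁)

end StructureIntegral

/-! Everything reduces to a trapping condition: near each `w` in the open interval, the level sets
`Σ_v` stay in one compact set `Q` on which `dψ ≠ 0`. Then `g` may be replaced by a compactly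
supported function and cut up by a partition of unity. In a chart whose first coordinate is `ψ`, the
area formula turns each piece into `∫ k (v, y) dy` with `k` smooth and compactly supported, and one
differentiates under the integral. With a gradient bound, a compact slab `{a ≤ ψ ≤ b}` serves as
`Q`. In the Morse cases the trapping comes from the diffeomorphisms, in two steps.

No critical points: nondegenerate critical points are isolated, so critical values are countable and
some level `v'` is regular. Through a diffeomorphism with this regular level, `Σ_v` is locally the
image of a smooth retraction `ρ`. At a critical point `p`, expanding `ψ ∘ ρ = ψ p` to second order
makes the range of `Dρ(p)` isotropic for the Hessian, whereas the zeros of a nondegenerate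
indefinite form spread too widely to be fixed by `ρ` to first order
(`false_of_retraction_onto_level_of_nondegenerate`).

No escape: a compact regular level has a largest number `m` of clopen pieces. A nearby level keeps a
part near each piece, so if it also left `Q` it would have `m + 1` pieces and could not be
homeomorphic to `Σ_w` (`exists_isCompact_eventually_levelSet_subset`). -/

section

open Filter Topology Module
open scoped NNReal ENNReal

/-! ### Area formula for smoothly parametrised pieces of hypersurface. -/

section AreaFormula

/-- The correspondence `b y ↦ a y` is well defined and `K`-Lipschitz from `b '' A` onto `a '' A`.
Having two maps out of a common set lets `φ` and its derivative be compared in both directions. -/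
theorem euclideanHausdorffMeasure_image_le_of_edist_le {α X Y : Type*}
    [EMetricSpace X] [MeasurableSpace X] [BorelSpace X]
    [EMetricSpace Y] [MeasurableSpace Y] [BorelSpace Y] {a : α → X} {b : α → Y} {A : Set α}
    {K : ℝ≥0} (h : ∀ y ∈ A, ∀ y' ∈ A, edist (a y) (a y') ≤ K * edist (b y) (b y')) (d : ℕ) :
    (Measure.euclideanHausdorffMeasure d : Measure X) (a '' A)
      ≤ (K : ℝ≥0∞) ^ d * (Measure.euclideanHausdorffMeasure d : Measure Y) (b '' A) := by
  rcases A.eq_empty_or_nonempty with rfl | ⟨y₀, -⟩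
  · simp
  have : Nonempty α := ⟨y₀⟩
  have hmem : ∀ y ∈ A, Function.invFunOn b A (b y) ∈ A ∧ b (Function.invFunOn b A (b y)) = b y :=
    fun y hy => ⟨Function.invFunOn_mem ⟨y, hy, rfl⟩, Function.invFunOn_eq ⟨y, hy, rfl⟩⟩
  have hlip : LipschitzOnWith K (a ∘ Function.invFunOn b A) (b '' A) := by
    rintro _ ⟨y, hy, rfl⟩ _ ⟨y', hy', rfl⟩
    have := h _ (hmem y hy).1 _ (hmem y' hy').1
    rwa [(hmem y hy).2, (hmem y' hy').2] at this
  have himage : (a ∘ Function.invFunOn b A) '' (b '' A) = a '' A := by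
    rw [image_image]
    refine image_congr fun y hy => ?_
    have := h _ (hmem y hy).1 _ hy
    rw [(hmem y hy).2, edist_self, mul_zero, nonpos_iff_eq_zero] at this
    exact edist_eq_zero.1 this
  have := hlip.hausdorffMeasure_image_le (d := d) (Nat.cast_nonneg _)
  rw [himage, ENNReal.rpow_natCast] at this
  simp only [Measure.euclideanHausdorffMeasure_def, Measure.smul_apply]
  rw [mul_smul_comm]
  gcongr

variable {H E : Type*} [NormedAddCommGroup H] [InnerProductSpace ℝ H] [FiniteDimensional ℝ H]
  [NormedAddCommGroup E] [InnerProductSpace ℝ E]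

theorem HasStrictFDerivAt.exists_nhds_edist_le {φ : H → E} {φ' : H →L[ℝ] E} {x : H}
    (hφ : HasStrictFDerivAt φ φ' x) (hinj : Function.Injective φ') {K : ℝ≥0} (hK : 1 < K) :
    ∃ s ∈ 𝓝 x, ∀ y ∈ s, ∀ y' ∈ s,
      edist (φ y) (φ y') ≤ K * edist (φ' y) (φ' y') ∧
      edist (φ' y) (φ' y') ≤ K * edist (φ y) (φ y') := by
  obtain ⟨κ, hκ, hanti⟩ :=
    (φ' : H →ₗ[ℝ] E).exists_antilipschitzWith (LinearMap.ker_eq_bot.2 hinj)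
  have hK' : (1 : ℝ) < K := by exact_mod_cast hK
  have hκ' : (0 : ℝ) < κ := by exact_mod_cast hκ
  -- With this `δ` the linearisation error is at most `(1 - 1/K) ‖φ' (y - y')‖`, so `‖φ y - φ y'‖ /
  -- ‖φ' (y - y')‖` lies between `1/K` and `2 - 1/K ≤ K`.
  obtain ⟨δ, hδ, hδκ⟩ : ∃ δ : ℝ, 0 < δ ∧ δ * κ = 1 - 1 / K := by
    refine ⟨(1 - 1 / K) / κ, div_pos (sub_pos.2 ?_) hκ', by field_simp⟩
    rw [div_lt_one (by positivity)]; exact hK'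
  have hev := (hasStrictFDerivAt_iff_isLittleO.1 hφ).def hδ
  rw [nhds_prod_eq] at hev
  obtain ⟨s, hs, hle⟩ := mem_prod_self_iff.1 hev
  refine ⟨s, hs, fun y hy y' hy' => ?_⟩
  have h1 : ‖φ y - φ y' - φ' (y - y')‖ ≤ δ * ‖y - y'‖ := hle (mk_mem_prod hy hy')
  have h2 : ‖y - y'‖ ≤ κ * ‖φ' (y - y')‖ := by
    simpa [dist_eq_norm, map_sub] using hanti.le_mul_dist y y'
  have h3 : ‖φ y - φ y' - φ' (y - y')‖ ≤ (1 - 1 / K) * ‖φ' (y - y')‖ := by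
    rw [← hδκ, mul_assoc]
    exact h1.trans (mul_le_mul_of_nonneg_left h2 hδ.le)
  have h4 : ‖φ y - φ y'‖ ≤ ‖φ y - φ y' - φ' (y - y')‖ + ‖φ' (y - y')‖ := by
    simpa using norm_add_le (φ y - φ y' - φ' (y - y')) (φ' (y - y'))
  have h5 : ‖φ' (y - y')‖ ≤ ‖φ y - φ y' - φ' (y - y')‖ + ‖φ y - φ y'‖ := by
    simpa [add_comm] using norm_sub_le (φ y - φ y') (φ y - φ y' - φ' (y - y'))
  have h6 : 1 / (K : ℝ) * K = 1 := by field_simp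
  set a := ‖φ' (y - y')‖
  have ha : 0 ≤ a := norm_nonneg _
  have hb := norm_nonneg (φ y - φ y')
  have h7 : 2 - 1 / (K : ℝ) ≤ K := by
    rw [sub_le_iff_le_add, ← sub_nonneg]
    have : (K : ℝ) + 1 / K - 2 = (K - 1) ^ 2 / K := by field_simp; ring
    rw [this]; positivity
  have key1 : ‖φ y - φ y'‖ ≤ K * a := by nlinarith
  have key2 : a ≤ K * ‖φ y - φ y'‖ := by
    have : 1 / (K : ℝ) * a ≤ ‖φ y - φ y'‖ := by linarith
    calc a = K * (1 / K * a) := by field_simp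
      _ ≤ _ := by gcongr
  rw [edist_dist, edist_dist, dist_eq_norm, dist_eq_norm, ← map_sub,
    show (K : ℝ≥0∞) = ENNReal.ofReal K by simp, ← ENNReal.ofReal_mul (by positivity),
    ← ENNReal.ofReal_mul (by positivity)]
  exact ⟨ENNReal.ofReal_le_ofReal key1, ENNReal.ofReal_le_ofReal key2⟩

variable [MeasurableSpace H] [BorelSpace H] [MeasurableSpace E] [BorelSpace E]

theorem HasStrictFDerivAt.exists_nhds_measure_image_le {φ : H → E} {φ' : H →L[ℝ] E} {x : H}
    (hφ : HasStrictFDerivAt φ φ' x) (hinj : Function.Injective φ') {C : ℝ≥0} (hC : 1 < C) :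
    ∃ s ∈ 𝓝 x, ∀ A ⊆ s,
      (Measure.euclideanHausdorffMeasure (finrank ℝ H) : Measure E) (φ '' A)
        ≤ C * (ENNReal.ofReal (φ' : H →ₗ[ℝ] E).normDet * volume A) ∧
      ENNReal.ofReal (φ' : H →ₗ[ℝ] E).normDet * volume A
        ≤ C * (Measure.euclideanHausdorffMeasure (finrank ℝ H) : Measure E) (φ '' A) := by
  obtain ⟨K, hK, hKC⟩ : ∃ K : ℝ≥0, 1 < K ∧ K ^ finrank ℝ H ≤ C := by
    have h1 : Tendsto (fun K : ℝ≥0 => K ^ finrank ℝ H) (𝓝[>] 1) (𝓝 (1 ^ finrank ℝ H)) :=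
      ((continuous_pow _).tendsto _).mono_left nhdsWithin_le_nhds
    rw [one_pow] at h1
    obtain ⟨K, hK, hK'⟩ := ((h1.eventually (gt_mem_nhds hC)).and self_mem_nhdsWithin).exists
    exact ⟨K, hK', hK.le⟩
  obtain ⟨s, hs, hle⟩ := hφ.exists_nhds_edist_le hinj hK
  have hKC' : (K : ℝ≥0∞) ^ finrank ℝ H ≤ C := by exact_mod_cast hKC
  have hlin : ∀ A : Set H,
      (Measure.euclideanHausdorffMeasure (finrank ℝ H) : Measure E) (φ' '' A) =
        ENNReal.ofReal (φ' : H →ₗ[ℝ] E).normDet * volume A := fun A =>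
    (φ' : H →ₗ[ℝ] E).euclideanHausdorffMeasure_image_eq_normDet_mul_volume A
  refine ⟨s, hs, fun A hA => ?_⟩
  rw [← hlin]
  constructor
  · refine (euclideanHausdorffMeasure_image_le_of_edist_le (b := φ')
      (fun y hy y' hy' => (hle y (hA hy) y' (hA hy')).1) _).trans ?_
    gcongr
  · refine (euclideanHausdorffMeasure_image_le_of_edist_le (a := φ') (b := φ)
      (fun y hy y' hy' => (hle y (hA hy) y' (hA hy')).2) _).trans ?_
    gcongr

/-- Countably many of the neighbourhoods cover `T`; cutting them into disjoint pieces gives `μ ≤ C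
ν` on `T` for every `C > 1`, and then `C → 1`. -/
theorem MeasureTheory.Measure.le_of_locally_le_mul {X : Type*} [TopologicalSpace X]
    [SecondCountableTopology X] [MeasurableSpace X] [OpensMeasurableSpace X] {μ ν : Measure X}
    {T : Set X} (hT : MeasurableSet T) (hμ : μ Tᶜ = 0)
    (h : ∀ C : ℝ≥0, 1 < C → ∀ x ∈ T, ∃ s ∈ 𝓝 x, ∀ A ⊆ s ∩ T, MeasurableSet A → μ A ≤ C * ν A) :
    μ ≤ ν := by
  have key : ∀ C : ℝ≥0, 1 < C → ∀ A ⊆ T, MeasurableSet A → μ A ≤ C * ν A := by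
    intro C hC A hAT hA
    choose! s hs hle using h C hC
    obtain ⟨t, htT, htc, hcov⟩ := TopologicalSpace.countable_cover_nhdsWithin
      (s := T) (f := fun x => interior (s x))
      (fun x hx => mem_nhdsWithin_of_mem_nhds (interior_mem_nhds.2 (hs x hx)))
    rcases t.eq_empty_or_nonempty with rfl | hne
    · have : A = ∅ := subset_empty_iff.1 (hAT.trans (by simpa using hcov))
      simp [this]
    obtain ⟨u, rfl⟩ := htc.exists_eq_range hne
    have hu : ∀ k, u k ∈ T := fun k => htT (mem_range_self k)
    let B : ℕ → Set X := disjointed fun k => interior (s (u k))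
    have hBm : ∀ k, MeasurableSet (A ∩ B k) := fun k =>
      hA.inter (MeasurableSet.disjointed (fun _ => isOpen_interior.measurableSet) k)
    have hBd : Pairwise (Function.onFun Disjoint fun k => A ∩ B k) := fun i j hij =>
      (disjoint_disjointed _ hij).mono inter_subset_right inter_subset_right
    have hAeq : A = ⋃ k, A ∩ B k := by
      rw [← inter_iUnion, iUnion_disjointed, eq_comm, inter_eq_left]
      refine hAT.trans (hcov.trans ?_)
      simp
    rw [hAeq, measure_iUnion hBd hBm, measure_iUnion hBd hBm, ← ENNReal.tsum_mul_left]
    refine ENNReal.tsum_le_tsum fun k => hle _ (hu k) _ ?_ (hBm k)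
    exact fun x hx =>
      ⟨interior_subset (disjointed_subset (fun k => interior (s (u k))) k hx.2), hAT hx.1⟩
  refine Measure.le_iff.2 fun A hA => ?_
  have h1 : μ A = μ (A ∩ T) := by
    rw [← measure_inter_add_sdiff A hT]
    have : μ (A \ T) = 0 := measure_mono_null (fun x hx => hx.2) hμ
    rw [this, add_zero]
  rw [h1]
  refine le_trans ?_ (measure_mono (inter_subset_left (t := T)))
  rcases eq_or_ne (ν (A ∩ T)) ⊤ with htop | htop
  · simp [htop]
  have hlim : Tendsto (fun C : ℝ≥0 => (C : ℝ≥0∞) * ν (A ∩ T)) (𝓝[>] 1) (𝓝 (1 * ν (A ∩ T))) := by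
    refine ENNReal.Tendsto.mul_const ?_ (Or.inr htop)
    exact (ENNReal.tendsto_coe.2 tendsto_id).mono_left nhdsWithin_le_nhds
  rw [one_mul] at hlim
  exact ge_of_tendsto hlim (eventually_mem_nhdsWithin.mono fun C hC =>
    key C hC _ inter_subset_right (hA.inter hT))

end AreaFormula

section AreaFormula

variable {H E : Type*} [NormedAddCommGroup H] [InnerProductSpace ℝ H] [FiniteDimensional ℝ H]
  [MeasurableSpace H] [BorelSpace H] [NormedAddCommGroup E] [InnerProductSpace ℝ E]
  [MeasurableSpace E] [BorelSpace E]

/-- Near each point both sides agree up to a factor arbitrarily close to `1`, because `φ` is nearly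
its derivative and the Jacobian is nearly constant; the local comparison principle, applied in both
directions, gives equality. -/
theorem map_restrict_euclideanHausdorffMeasure_image {φ : H → E} {φ' : H → H →L[ℝ] E} {π : E → H}
    {T : Set H} (hT : IsOpen T) (hπ : Continuous π) (hπφ : ∀ y ∈ T, π (φ y) = y)
    (hφ : ∀ y ∈ T, HasStrictFDerivAt φ (φ' y) y) (hinj : ∀ y ∈ T, Function.Injective (φ' y))
    (hJ : ContinuousOn (fun y => (φ' y : H →ₗ[ℝ] E).normDet) T) :
    (((Measure.euclideanHausdorffMeasure (finrank ℝ H) : Measure E).restrict (φ '' T)).map π) =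
      (volume.restrict T).withDensity
        (fun y => ENNReal.ofReal (φ' y : H →ₗ[ℝ] E).normDet) := by
  set σ := (Measure.euclideanHausdorffMeasure (finrank ℝ H) : Measure E)
  set J : H → ℝ := fun y => (φ' y : H →ₗ[ℝ] E).normDet
  have hJpos : ∀ y ∈ T, 0 < J y := fun y hy => by
    refine (LinearMap.normDet_nonneg _).lt_of_ne' ?_
    rw [Ne, LinearMap.normDet_eq_zero_iff_ker_ne_bot, not_not]
    exact LinearMap.ker_eq_bot.2 (hinj y hy)
  have hν : ∀ A ⊆ T, MeasurableSet A → (σ.restrict (φ '' T)).map π A = σ (φ '' A) := by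
    intro A hAT hA
    rw [Measure.map_apply hπ.measurable hA, Measure.restrict_apply (hπ.measurable hA)]
    congr 1
    ext x
    constructor
    · rintro ⟨hx, y, hy, rfl⟩
      rw [mem_preimage, hπφ y hy] at hx
      exact ⟨y, hx, rfl⟩
    · rintro ⟨y, hy, rfl⟩
      exact ⟨by rwa [mem_preimage, hπφ y (hAT hy)], y, hAT hy, rfl⟩
  have hρ : ∀ A ⊆ T, MeasurableSet A → (volume.restrict T).withDensity
      (fun y => ENNReal.ofReal (J y)) A = ∫⁻ y in A, ENNReal.ofReal (J y) := by
    intro A hAT hA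
    rw [withDensity_apply _ hA, Measure.restrict_restrict hA, inter_eq_self_of_subset_left hAT]
  have hnear : ∀ C : ℝ≥0, 1 < C → ∀ x ∈ T, ∃ s ∈ 𝓝 x, ∀ y ∈ s,
      J x ≤ C * J y ∧ J y ≤ C * J x := by
    intro C hC x hx
    have hC' : (1 : ℝ) < C := by exact_mod_cast hC
    have hcont : ContinuousAt J x := hJ.continuousAt (hT.mem_nhds hx)
    have h1 : ∀ᶠ y in 𝓝 x, J x < C * J y :=
      (hcont.const_mul (C : ℝ)).eventually
        (lt_mem_nhds (show J x < C * J x by nlinarith [hJpos x hx]))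
    have h2 : ∀ᶠ y in 𝓝 x, J y < C * J x :=
      hcont.eventually (gt_mem_nhds (by nlinarith [hJpos x hx]))
    exact ⟨_, h1.and h2, fun y hy => ⟨hy.1.le, hy.2.le⟩⟩
  have hmul : ∀ (C : ℝ≥0) (a : ℝ), ENNReal.ofReal (C * a) = C * ENNReal.ofReal a := fun C a => by
    rw [ENNReal.ofReal_mul C.coe_nonneg, ENNReal.ofReal_coe_nnreal]
  -- One factor `B` pays for replacing `φ` by its derivative, the other for freezing the Jacobian at
  -- `x`.
  have hsqrt : ∀ C : ℝ≥0, 1 < C → ∃ B : ℝ≥0, 1 < B ∧ (C : ℝ≥0∞) = B * B := fun C hC =>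
    ⟨NNReal.sqrt C, by simpa using NNReal.sqrt_lt_sqrt.2 hC, by
      rw [← ENNReal.coe_mul, NNReal.mul_self_sqrt]⟩
  refine le_antisymm (Measure.le_of_locally_le_mul hT.measurableSet ?_ ?_)
    (Measure.le_of_locally_le_mul hT.measurableSet ?_ ?_)
  · rw [Measure.map_apply hπ.measurable hT.measurableSet.compl,
      Measure.restrict_apply (hπ.measurable hT.measurableSet.compl)]
    convert measure_empty (μ := σ)
    rw [eq_empty_iff_forall_notMem]
    rintro _ ⟨hx, y, hy, rfl⟩
    exact hx (by rwa [hπφ y hy])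
  · intro C hC x hx
    obtain ⟨B, hB, hBC⟩ := hsqrt C hC
    obtain ⟨s, hs, hle⟩ := (hφ x hx).exists_nhds_measure_image_le (hinj x hx) hB
    obtain ⟨s', hs', hle'⟩ := hnear B hB x hx
    refine ⟨s ∩ s', inter_mem hs hs', fun A hA hAm => ?_⟩
    have hAT : A ⊆ T := fun y hy => (hA hy).2
    rw [hν A hAT hAm, hρ A hAT hAm]
    refine (hle A fun y hy => (hA hy).1.1).1.trans ?_
    rw [hBC, mul_assoc]
    refine mul_le_mul_right ?_ _
    rw [← setLIntegral_const, ← lintegral_const_mul' _ _ ENNReal.coe_ne_top]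
    refine setLIntegral_mono' hAm fun y hy => ?_
    rw [← hmul]
    exact ENNReal.ofReal_le_ofReal (hle' y (hA hy).1.2).1
  · rw [withDensity_apply _ hT.measurableSet.compl,
      Measure.restrict_restrict hT.measurableSet.compl]
    simp
  · intro C hC x hx
    obtain ⟨B, hB, hBC⟩ := hsqrt C hC
    obtain ⟨s, hs, hle⟩ := (hφ x hx).exists_nhds_measure_image_le (hinj x hx) hB
    obtain ⟨s', hs', hle'⟩ := hnear B hB x hx
    refine ⟨s ∩ s', inter_mem hs hs', fun A hA hAm => ?_⟩
    have hAT : A ⊆ T := fun y hy => (hA hy).2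
    rw [hν A hAT hAm, hρ A hAT hAm, hBC, mul_assoc]
    refine le_trans ?_ (mul_le_mul_right (hle A fun y hy => (hA hy).1.1).2 _)
    rw [← setLIntegral_const, ← lintegral_const_mul' _ _ ENNReal.coe_ne_top]
    refine setLIntegral_mono' hAm fun y hy => ?_
    rw [← hmul]
    exact ENNReal.ofReal_le_ofReal (hle' y (hA hy).1.2).2

theorem integrableOn_image_iff_and_setIntegral_image {φ : H → E} {φ' : H → H →L[ℝ] E} {π : E → H}
    {T : Set H} (hT : IsOpen T) (hπ : Continuous π) (hπφ : ∀ y ∈ T, π (φ y) = y)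
    (hφ : ∀ y ∈ T, HasStrictFDerivAt φ (φ' y) y) (hinj : ∀ y ∈ T, Function.Injective (φ' y))
    (hJ : ContinuousOn (fun y => (φ' y : H →ₗ[ℝ] E).normDet) T) (hm : MeasurableSet (φ '' T))
    {g : E → ℝ} (hg : ContinuousOn g (φ '' T)) :
    (IntegrableOn g (φ '' T) (Measure.euclideanHausdorffMeasure (finrank ℝ H)) ↔
      IntegrableOn (fun y => (φ' y : H →ₗ[ℝ] E).normDet * g (φ y)) T) ∧
    ∫ x in φ '' T, g x ∂(Measure.euclideanHausdorffMeasure (finrank ℝ H)) =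
      ∫ y in T, (φ' y : H →ₗ[ℝ] E).normDet * g (φ y) := by
  set σ := (Measure.euclideanHausdorffMeasure (finrank ℝ H) : Measure E)
  set J : H → ℝ := fun y => (φ' y : H →ₗ[ℝ] E).normDet
  have hmap := map_restrict_euclideanHausdorffMeasure_image hT hπ hπφ hφ hinj hJ
  have hφc : ContinuousOn φ T := fun y hy => (hφ y hy).continuousAt.continuousWithinAt
  have hgφ : ContinuousOn (g ∘ φ) T := hg.comp hφc (mapsTo_image _ _)
  have hgπ : ∀ᵐ x ∂(σ.restrict (φ '' T)), (g ∘ φ) (π x) = g x := by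
    refine (ae_restrict_iff' hm).2 (Eventually.of_forall ?_)
    rintro _ ⟨y, hy, rfl⟩
    simp [hπφ y hy]
  have hae : AEStronglyMeasurable (g ∘ φ) ((σ.restrict (φ '' T)).map π) := by
    rw [hmap]
    exact (hgφ.aestronglyMeasurable hT.measurableSet).mono_ac (withDensity_absolutelyContinuous _ _)
  have hJm : AEMeasurable (fun y => Real.toNNReal (J y)) (volume.restrict T) :=
    (hJ.aemeasurable hT.measurableSet).real_toNNReal
  have hcoe : ∀ y, ((Real.toNNReal (J y) : ℝ≥0) : ℝ) = J y := fun y =>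
    Real.coe_toNNReal _ (LinearMap.normDet_nonneg _)
  constructor
  · unfold IntegrableOn
    rw [← integrable_congr hgπ, ← Function.comp_def (g ∘ φ) π,
      ← integrable_map_measure hae hπ.aemeasurable, hmap]
    change Integrable (g ∘ φ) ((volume.restrict T).withDensity
      fun y => ((Real.toNNReal (J y) : ℝ≥0) : ℝ≥0∞)) ↔ _
    rw [integrable_withDensity_iff_integrable_coe_smul₀ hJm]
    simp only [hcoe, smul_eq_mul, Function.comp]; rfl
  · rw [← integral_congr_ae hgπ, ← integral_map hπ.aemeasurable hae, hmap]
    change ∫ y, (g ∘ φ) y ∂((volume.restrict T).withDensity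
      fun y => ((Real.toNNReal (J y) : ℝ≥0) : ℝ≥0∞)) = _
    rw [integral_withDensity_eq_integral_smul₀ hJm]
    simp only [NNReal.smul_def, hcoe, smul_eq_mul, Function.comp]; rfl

end AreaFormula

/-! ### Charts adapted to the level sets near regular points. -/

section Charts

/-- The Jacobian is the square root of a Gram determinant, which injectivity keeps away from `0`,
the only point where the root is not smooth. -/
theorem contDiffOn_normDet {E F H : Type*}
    [NormedAddCommGroup E] [InnerProductSpace ℝ E] [NormedAddCommGroup F] [NormedSpace ℝ F]
    [NormedAddCommGroup H] [InnerProductSpace ℝ H] [FiniteDimensional ℝ H] {L : F → H →L[ℝ] E}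
    {s : Set F} (hL : ContDiffOn ℝ ∞ L s) (hinj : ∀ z ∈ s, Function.Injective (L z)) :
    ContDiffOn ℝ ∞ (fun z => (L z : H →ₗ[ℝ] E).normDet) s := by
  classical
  set b := stdOrthonormalBasis ℝ H
  have heq : ∀ z, (L z : H →ₗ[ℝ] E).normDet =
      √((Matrix.gram ℝ fun i => L z (b i)).det) := by
    intro z
    have : (L z : H →ₗ[ℝ] E).normDet ^ 2 = (Matrix.gram ℝ fun i => L z (b i)).det :=
      (L z : H →ₗ[ℝ] E).normDet_sq_eq_det_gram b
    rw [← this, Real.sqrt_sq (LinearMap.normDet_nonneg _)]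
  simp_rw [heq]
  refine ContDiffOn.sqrt ?_ ?_
  · simp only [Matrix.det_apply, Matrix.gram_apply]
    refine ContDiffOn.sum fun σ _ => ContDiffOn.const_smul _ ?_
    refine contDiffOn_prod fun i _ => ?_
    exact (hL.clm_apply contDiffOn_const).inner ℝ (hL.clm_apply contDiffOn_const)
  · intro z hz h
    have h0 := heq z
    rw [h, Real.sqrt_zero, LinearMap.normDet_eq_zero_iff_ker_ne_bot] at h0
    exact h0 (LinearMap.ker_eq_bot.2 (hinj z hz))

variable {E : Type*} [NormedAddCommGroup E] [InnerProductSpace ℝ E] [FiniteDimensional ℝ E]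

theorem exists_continuousLinearEquiv_prod_orthogonalProjectionOnto {n : E} (l : E →L[ℝ] ℝ)
    (hl : l n ≠ 0) :
    ∃ A : E ≃L[ℝ] ℝ × (ℝ ∙ n)ᗮ, (A : E →L[ℝ] ℝ × (ℝ ∙ n)ᗮ) =
      l.prod (ℝ ∙ n)ᗮ.orthogonalProjectionOnto := by
  have hn : n ≠ 0 := fun h => hl (by simp [h])
  have hinj : Function.Injective 
      ((l.prod (ℝ ∙ n)ᗮ.orthogonalProjectionOnto : E →L[ℝ] ℝ × (ℝ ∙ n)ᗮ) :
        E →ₗ[ℝ] ℝ × (ℝ ∙ n)ᗮ) := by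
    refine (injective_iff_map_eq_zero _).2 fun x hx => ?_
    have h1 : l x = 0 := congrArg Prod.fst hx
    have h2 : (ℝ ∙ n)ᗮ.orthogonalProjectionOnto x = 0 := congrArg Prod.snd hx
    rw [Submodule.orthogonalProjectionOnto_eq_zero_iff, Submodule.orthogonal_orthogonal,
      Submodule.mem_span_singleton] at h2
    obtain ⟨c, rfl⟩ := h2
    have : c = 0 := by simpa [hl] using h1
    simp [this]
  have hdim : finrank ℝ E = finrank ℝ (ℝ × (ℝ ∙ n)ᗮ) := by
    rw [finrank_prod, finrank_self, ← finrank_span_singleton (K := ℝ) hn,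
      Submodule.finrank_add_finrank_orthogonal]
  exact ⟨(LinearEquiv.ofInjectiveOfFinrankEq _ hinj hdim).toContinuousLinearEquiv, rfl⟩

/-- Near a regular point, `ψ` and an orthogonal projection to a hyperplane form a coordinate
system. -/
theorem exists_chart_of_fderiv_ne_zero {U : Set E} {ψ : E → ℝ} (hU : IsOpen U)
    (hψ : ContDiffOn ℝ ∞ ψ U) {p : E} (hp : p ∈ U) (hreg : fderiv ℝ ψ p ≠ 0) :
    ∃ (H : Submodule ℝ E) (e : OpenPartialHomeomorph E (ℝ × H)),
      finrank ℝ H + 1 = finrank ℝ E ∧ p ∈ e.source ∧ e.source ⊆ U ∧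
      (∀ x, e x = (ψ x, H.orthogonalProjectionOnto x)) ∧ ContDiffOn ℝ ∞ e.symm e.target := by
  obtain ⟨n, hn⟩ : ∃ n, fderiv ℝ ψ p n ≠ 0 := by
    by_contra! h
    exact hreg (ContinuousLinearMap.ext h)
  have hn0 : n ≠ 0 := fun h => hn (by simp [h])
  set π := (ℝ ∙ n)ᗮ.orthogonalProjectionOnto with hπ
  set G : E → ℝ × (ℝ ∙ n)ᗮ := fun x => (ψ x, π x) with hG
  have hψat : ∀ x ∈ U, ContDiffAt ℝ ∞ ψ x := fun x hx => hψ.contDiffAt (hU.mem_nhds hx)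
  have hGat : ∀ x ∈ U, ContDiffAt ℝ ∞ G x := fun x hx =>
    (hψat x hx).prodMk π.contDiff.contDiffAt
  have hderiv : ∀ x ∈ U, fderiv ℝ ψ x n ≠ 0 →
      ∃ A : E ≃L[ℝ] ℝ × (ℝ ∙ n)ᗮ, HasFDerivAt G (A : E →L[ℝ] ℝ × (ℝ ∙ n)ᗮ) x := by
    intro x hx hxn
    obtain ⟨A, hA⟩ := exists_continuousLinearEquiv_prod_orthogonalProjectionOnto _ hxn
    refine ⟨A, ?_⟩
    rw [hA]
    exact ((hψat x hx).differentiableAt (by simp)).hasFDerivAt.prodMk π.hasFDerivAt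
  -- On `R` the derivative of `G` is invertible everywhere, so after restriction to `R` the inverse
  -- chart is smooth on its whole target and not just at the image of `p`.
  set R : Set E := {x ∈ U | fderiv ℝ ψ x n ≠ 0} with hR
  have hRo : IsOpen R := by
    have hc : ContinuousOn (fun x => fderiv ℝ ψ x n) U :=
      (hψ.continuousOn_fderiv_of_isOpen hU (by simp)).clm_apply continuousOn_const
    exact hc.isOpen_inter_preimage hU isOpen_ne
  obtain ⟨A, hA⟩ := hderiv p hp hn
  set e₀ := (hGat p hp).toOpenPartialHomeomorph G hA (by simp) with he₀
  have hcoe : ∀ x, e₀ x = G x := fun x => rfl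
  refine ⟨(ℝ ∙ n)ᗮ, e₀.restrOpen R hRo, ?_, ?_, ?_, fun x => rfl, ?_⟩
  · rw [← Submodule.finrank_add_finrank_orthogonal (ℝ ∙ n), finrank_span_singleton hn0, add_comm]
  · exact ⟨(hGat p hp).mem_toOpenPartialHomeomorph_source hA (by simp), hp, hn⟩
  · exact fun x hx => hx.2.1
  · intro z hz
    set e := e₀.restrOpen R hRo
    have hs : e.symm z ∈ R := (e.map_target hz).2
    obtain ⟨B, hB⟩ := hderiv _ hs.1 hs.2
    exact (e.contDiffAt_symm hz hB (hGat _ hs.1)).contDiffWithinAt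

end Charts

/-! ### Level integrals of functions supported in one chart. -/

section LevelIntegrals

theorem contDiff_integral_of_hasCompactSupport {P H : Type*} [NormedAddCommGroup P]
    [NormedSpace ℝ P] [NormedAddCommGroup H] [NormedSpace ℝ H] [MeasurableSpace H] [BorelSpace H]
    {μ : Measure H} [IsLocallyFiniteMeasure μ] {k : P × H → ℝ} (hk : ContDiff ℝ ∞ k)
    (hc : HasCompactSupport k) : ContDiff ℝ ∞ fun v => ∫ y, k (v, y) ∂μ := by
  set K : Set H := (fun z : P × H => -z.2) '' tsupport k
  have hK : IsCompact K := hc.isCompact.image (by fun_prop)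
  -- The integral is the convolution of the constant `1` with `y ↦ k (v, -y)`, evaluated at `0`.
  have h := contDiffOn_convolution_right_with_param (𝕜 := ℝ) (μ := μ) (n := ⊤)
    (f := fun _ : H => (1 : ℝ)) (ContinuousLinearMap.mul ℝ ℝ) (g := fun v y => k (v, -y))
    (s := univ) isOpen_univ hK (fun v x _ hx => ?_) (locallyIntegrable_const _) ?_
  · have h2 : ContDiff ℝ ∞ fun v : P => (v, (0 : H)) := by fun_prop
    rw [univ_prod_univ, contDiffOn_univ] at h
    have h3 := h.comp h2
    simpa [Function.comp_def, convolution] using h3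
  · by_contra hne
    exact hx ⟨(v, -x), subset_tsupport _ hne, by simp⟩
  · have : ContDiff ℝ ∞ fun q : P × H => (q.1, -q.2) := by fun_prop
    exact (hk.comp this).contDiffOn

theorem measurableSet_levelSet {E : Type*} [TopologicalSpace E] [MeasurableSpace E]
    [OpensMeasurableSpace E] {U : Set E} {ψ : E → ℝ} (hU : IsOpen U)
    (hψ : ContinuousOn ψ U) (v : ℝ) : MeasurableSet (StructureIntegral.levelSet U ψ v) := by
  have h : StructureIntegral.levelSet U ψ v = U \ (U ∩ ψ ⁻¹' {v}ᶜ) := by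
    ext x
    exact ⟨fun hx => ⟨hx.1, fun h => h.2 hx.2⟩, fun hx => ⟨hx.1, by_contra fun h => hx.2 ⟨hx.1, h⟩⟩⟩
  rw [h]
  exact hU.measurableSet.diff (hψ.isOpen_inter_preimage hU isOpen_compl_singleton).measurableSet

variable {E : Type*} [NormedAddCommGroup E] [InnerProductSpace ℝ E]
  [MeasurableSpace E] [BorelSpace E] [FiniteDimensional ℝ E]

/-- In the chart `(ψ, π)` the level `v` becomes the slice with first coordinate `v`, so its surface
integral is an integral over the fixed hyperplane `H` in which `v` is only a parameter. The
neighbourhood `W` is chosen before `g`, as the partition of unity requires. -/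
theorem exists_nhds_contDiff_setIntegral_levelSet {U : Set E} {ψ : E → ℝ} (hU : IsOpen U)
    (hψ : ContDiffOn ℝ ∞ ψ U) {p : E} (hp : p ∈ U) (hreg : fderiv ℝ ψ p ≠ 0) :
    ∃ W, IsOpen W ∧ p ∈ W ∧ ∀ g : E → ℝ, ContDiff ℝ ∞ g → HasCompactSupport g →
      tsupport g ⊆ W →
      (∀ v, IntegrableOn g (StructureIntegral.levelSet U ψ v)
        (Measure.euclideanHausdorffMeasure (finrank ℝ E - 1))) ∧
      ContDiff ℝ ∞ fun v => ∫ x in StructureIntegral.levelSet U ψ v, g x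
        ∂(Measure.euclideanHausdorffMeasure (finrank ℝ E - 1)) := by
  obtain ⟨H, e, hdim, hpe, heU, he, hes⟩ := exists_chart_of_fderiv_ne_zero hU hψ hp hreg
  refine ⟨e.source, e.open_source, hpe, fun g hg hgc hgs => ?_⟩
  rw [show finrank ℝ E - 1 = finrank ℝ H by omega]
  set π := H.orthogonalProjectionOnto
  set σ : Measure E := Measure.euclideanHausdorffMeasure (finrank ℝ H)
  have hesymm : ∀ z ∈ e.target, ψ (e.symm z) = z.1 ∧ π (e.symm z) = z.2 := fun z hz => by
    have := (he (e.symm z)).symm.trans (e.right_inv hz)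
    exact ⟨congrArg Prod.fst this, congrArg Prod.snd this⟩
  have hat : ∀ z ∈ e.target, ContDiffAt ℝ ∞ e.symm z := fun z hz =>
    hes.contDiffAt (e.open_target.mem_nhds hz)
  set L : ℝ × H → H →L[ℝ] E := fun z =>
    (fderiv ℝ e.symm z).comp (ContinuousLinearMap.inr ℝ ℝ H)
  have hLc : ContDiffOn ℝ ∞ L e.target :=
    (hes.fderiv_of_isOpen e.open_target (by simp)).clm_comp contDiffOn_const
  have hstrict : ∀ v y, (v, y) ∈ e.target →
      HasStrictFDerivAt (fun y => e.symm (v, y)) (L (v, y)) y := fun v y hz =>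
    ((hat _ hz).hasStrictFDerivAt (by simp)).comp y
      (hasStrictFDerivAt_const v y |>.prodMk (hasStrictFDerivAt_id y))
  have hTo : ∀ v, IsOpen {y : H | (v, y) ∈ e.target} := fun v =>
    e.open_target.preimage (by fun_prop : Continuous fun y : H => (v, y))
  have hinj : ∀ z ∈ e.target, Function.Injective (L z) := by
    rintro ⟨v, y⟩ hz
    have h1 : HasFDerivAt (fun y => π (e.symm (v, y))) (π.comp (L (v, y))) y :=
      π.hasFDerivAt.comp y (hstrict v y hz).hasFDerivAt
    have h2 : (fun y => π (e.symm (v, y))) =ᶠ[𝓝 y] id := by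
      filter_upwards [(hTo v).mem_nhds hz] with y' hy'
      exact (hesymm _ hy').2
    have h3 := h1.unique ((hasFDerivAt_id y).congr_of_eventuallyEq h2)
    exact Function.LeftInverse.injective (g := π) fun u => by
      simpa using DFunLike.congr_fun h3 u
  have hJc : ContDiffOn ℝ ∞ (fun z => (L z : H →ₗ[ℝ] E).normDet) e.target :=
    contDiffOn_normDet hLc hinj
  -- Extension by zero stays smooth because `k` vanishes off `e '' tsupport g`, a compact subset of
  -- the target.
  set k : ℝ × H → ℝ := e.target.indicator fun z => (L z : H →ₗ[ℝ] E).normDet * g (e.symm z)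
  have hks : ∀ z, z ∉ e '' tsupport g → k z = 0 := by
    intro z hz
    by_cases hzt : z ∈ e.target
    · have : g (e.symm z) = 0 := by
        by_contra hne
        exact hz ⟨e.symm z, subset_tsupport _ hne, e.right_inv hzt⟩
      simp [k, hzt, this]
    · simp [k, hzt]
  have hK : IsCompact (e '' tsupport g) :=
    hgc.isCompact.image_of_continuousOn (e.continuousOn.mono hgs)
  have hkc : HasCompactSupport k := HasCompactSupport.intro hK hks
  have hk : ContDiff ℝ ∞ k := by
    rw [contDiff_iff_contDiffAt]
    intro z
    by_cases hz : z ∈ e.target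
    · have h1 : ContDiffAt ℝ ∞ (fun z => (L z : H →ₗ[ℝ] E).normDet * g (e.symm z)) z :=
        (hJc.contDiffAt (e.open_target.mem_nhds hz)).mul (hg.contDiffAt.comp z (hat z hz))
      refine h1.congr_of_eventuallyEq ?_
      filter_upwards [e.open_target.mem_nhds hz] with z' hz'
      exact indicator_of_mem hz' _
    · have hz' : z ∈ (e '' tsupport g)ᶜ := fun hmem => by
        obtain ⟨x, hx, rfl⟩ := hmem
        exact hz (e.map_source (hgs hx))
      refine (contDiffAt_const (c := (0 : ℝ))).congr_of_eventuallyEq ?_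
      filter_upwards [hK.isClosed.isOpen_compl.mem_nhds hz'] with z'' hz''
      exact hks _ hz''
  have himage : ∀ v, (fun y => e.symm (v, y)) '' {y : H | (v, y) ∈ e.target} =
      StructureIntegral.levelSet U ψ v ∩ e.source := by
    intro v
    ext x
    constructor
    · rintro ⟨y, hy, rfl⟩
      have := e.map_target hy
      exact ⟨⟨heU this, (hesymm _ hy).1⟩, this⟩
    · rintro ⟨⟨hxU, hxv⟩, hxs⟩
      have hex : e x = (v, π x) := by rw [he, hxv]
      refine ⟨π x, ?_, ?_⟩
      · rw [mem_ofPred_eq, ← hex]; exact e.map_source hxs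
      · change e.symm (v, π x) = x
        rw [← hex, e.left_inv hxs]
  have hmeas := fun v => measurableSet_levelSet hU hψ.continuousOn v
  have hcore := fun v => integrableOn_image_iff_and_setIntegral_image (hTo v)
    (π := π) π.continuous (fun y hy => (hesymm _ hy).2) (fun y hy => hstrict v y hy)
    (fun y hy => hinj _ hy)
    (hJc.continuousOn.comp (by fun_prop : Continuous fun y : H => (v, y)).continuousOn
      (fun y hy => hy)) (by rw [himage]; exact (hmeas v).inter e.open_source.measurableSet)
    (g := g) hg.continuous.continuousOn
  simp only [himage] at hcore
  have hzero : ∀ v, ∀ x ∈ StructureIntegral.levelSet U ψ v \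
      (StructureIntegral.levelSet U ψ v ∩ e.source), g x = 0 := fun v x hx => by
    by_contra hne
    exact hx.2 ⟨hx.1, hgs (subset_tsupport _ hne)⟩
  have hkind : ∀ v, (fun y => k (v, y)) = {y : H | (v, y) ∈ e.target}.indicator
      fun y => (L (v, y) : H →ₗ[ℝ] E).normDet * g (e.symm (v, y)) := fun v => rfl
  refine ⟨fun v => ?_, ?_⟩
  · refine IntegrableOn.of_forall_sdiff_eq_zero ((hcore v).1.2 ?_) (hmeas v) (hzero v)
    rw [← integrable_indicator_iff (hTo v).measurableSet, ← hkind v]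
    have hcont : Continuous fun y => k (v, y) := hk.continuous.comp (by fun_prop)
    refine hcont.integrable_of_hasCompactSupport
      (HasCompactSupport.intro (hK.image continuous_snd) fun y hy => hks _ fun hmem => ?_)
    exact hy ⟨_, hmem, rfl⟩
  · have : (fun v => ∫ x in StructureIntegral.levelSet U ψ v, g x ∂σ) =
        fun v => ∫ y, k (v, y) := by
      funext v
      rw [setIntegral_eq_of_subset_of_forall_sdiff_eq_zero (hmeas v) inter_subset_left (hzero v),
        (hcore v).2, hkind v, integral_indicator (hTo v).measurableSet]
    rw [this]
    exact contDiff_integral_of_hasCompactSupport hk hkc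

end LevelIntegrals

/-! ### From charts to whole level sets: partition of unity and cutoff. -/

section LevelIntegrals

variable {E : Type*} [NormedAddCommGroup E] [InnerProductSpace ℝ E] [FiniteDimensional ℝ E]

open scoped Manifold in
theorem exists_finset_contDiff_sum_eq {ι : Type*} {g : E → ℝ}
    (hg : ContDiff ℝ ∞ g) (hgc : HasCompactSupport g) {W : ι → Set E} (hW : ∀ i, IsOpen (W i))
    (hcov : tsupport g ⊆ ⋃ i, W i) :
    ∃ (t : Finset ι) (h : ι → E → ℝ), (∀ i, ContDiff ℝ ∞ (h i) ∧ HasCompactSupport (h i) ∧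
      tsupport (h i) ⊆ W i) ∧ g = fun x => ∑ i ∈ t, h i x := by
  obtain ⟨f, hf⟩ := SmoothPartitionOfUnity.exists_isSubordinate 𝓘(ℝ, E)
    (isClosed_tsupport g) W hW hcov
  have hfin := f.locallyFinite.finite_nonempty_inter_compact hgc.isCompact
  refine ⟨hfin.toFinset, fun i x => f i x * g x, fun i => ⟨?_, hgc.mul_left, ?_⟩, ?_⟩
  · exact (contMDiff_iff_contDiff.1 (f i).contMDiff).mul hg
  · exact (tsupport_mul_subset_left (f := f i) (g := g)).trans (hf i)
  · funext x
    rw [← Finset.sum_mul]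
    by_cases hx : x ∈ tsupport g
    · have h1 := f.sum_eq_one hx
      rw [finsum_eq_sum_of_support_subset (s := hfin.toFinset)] at h1
      · rw [h1, one_mul]
      · intro i hi
        simp only [Finite.coe_toFinset]
        exact ⟨x, hi, hx⟩
    · rw [image_eq_zero_of_notMem_tsupport hx, mul_zero]

theorem exists_contDiff_eqOn_of_isCompact {R Q : Set E} (hR : IsOpen R) (hQ : IsCompact Q)
    (hQR : Q ⊆ R) {g : E → ℝ} (hg : ContDiffOn ℝ ∞ g R) :
    ∃ g' : E → ℝ, ContDiff ℝ ∞ g' ∧ HasCompactSupport g' ∧ tsupport g' ⊆ R ∧ EqOn g' g Q := by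
  obtain ⟨t, ht, hQt, htR⟩ := exists_compact_between hQ hR hQR
  obtain ⟨η, h1, h0, -⟩ := exists_contMDiffMap_one_nhds_of_subset_interior
    (modelWithCornersSelf ℝ E) (n := ⊤) hQ.isClosed hQt
  have hη : ContDiff ℝ ∞ η := contMDiff_iff_contDiff.1 η.contMDiff
  have hzero : ∀ x, x ∉ t → η x * g x = 0 := fun x hx => by rw [h0 x hx, zero_mul]
  refine ⟨fun x => η x * g x, ?_, HasCompactSupport.intro ht hzero, ?_, fun x hx => ?_⟩
  · rw [contDiff_iff_contDiffAt]
    intro x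
    by_cases hx : x ∈ R
    · exact hη.contDiffAt.mul (hg.contDiffAt (hR.mem_nhds hx))
    · refine (contDiffAt_const (c := (0 : ℝ))).congr_of_eventuallyEq ?_
      filter_upwards [ht.isClosed.isOpen_compl.mem_nhds fun hxt => hx (htR hxt)] with y hy
      exact hzero y hy
  · refine (closure_minimal (fun x hx => ?_) ht.isClosed).trans htR
    by_contra hxt
    exact hx (hzero x hxt)
  · change η x * g x = g x
    rw [h1.self_of_nhdsSet x hx, one_mul]

variable [MeasurableSpace E] [BorelSpace E]

theorem contDiff_setIntegral_levelSet_of_tsupport_subset {U : Set E} {ψ : E → ℝ} (hU : IsOpen U)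
    (hψ : ContDiffOn ℝ ∞ ψ U) {g : E → ℝ} (hg : ContDiff ℝ ∞ g) (hgc : HasCompactSupport g)
    (hgs : tsupport g ⊆ {x ∈ U | fderiv ℝ ψ x ≠ 0}) :
    (∀ v, IntegrableOn g (StructureIntegral.levelSet U ψ v)
        (Measure.euclideanHausdorffMeasure (finrank ℝ E - 1))) ∧
      ContDiff ℝ ∞ fun v => ∫ x in StructureIntegral.levelSet U ψ v, g x
        ∂(Measure.euclideanHausdorffMeasure (finrank ℝ E - 1)) := by
  choose W hWo hpW hW using fun p : tsupport g =>
    exists_nhds_contDiff_setIntegral_levelSet hU hψ (hgs p.2).1 (hgs p.2).2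
  obtain ⟨t, h, hh, hgsum⟩ := exists_finset_contDiff_sum_eq hg hgc hWo
    (fun x hx => mem_iUnion.2 ⟨⟨x, hx⟩, hpW ⟨x, hx⟩⟩)
  have hI := fun i => hW i (h i) (hh i).1 (hh i).2.1 (hh i).2.2
  rw [hgsum]
  refine ⟨fun v => integrable_finsetSum _ fun i _ => (hI i).1 v, ?_⟩
  simp_rw [fun v => integral_finsetSum t fun i _ => (hI i).1 v]
  exact ContDiff.sum fun i _ => (hI i).2

/-- Since the nearby levels lie in `Q`, changing `g` off `Q` does not affect their integrals.
Smoothness of `g` is asked only at regular points so that `1 / ‖∇ψ‖` is admissible. -/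
theorem contDiffAt_setIntegral_levelSet {U : Set E} {ψ : E → ℝ} (hU : IsOpen U)
    (hψ : ContDiffOn ℝ ∞ ψ U) {g : E → ℝ} (hg : ContDiffOn ℝ ∞ g {x ∈ U | fderiv ℝ ψ x ≠ 0})
    {Q : Set E} (hQ : IsCompact Q) (hQR : Q ⊆ {x ∈ U | fderiv ℝ ψ x ≠ 0}) {w : ℝ}
    (hev : ∀ᶠ v in 𝓝 w, StructureIntegral.levelSet U ψ v ⊆ Q) :
    IntegrableOn g (StructureIntegral.levelSet U ψ w)
        (Measure.euclideanHausdorffMeasure (finrank ℝ E - 1)) ∧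
      ContDiffAt ℝ ∞ (fun v => ∫ x in StructureIntegral.levelSet U ψ v, g x
        ∂(Measure.euclideanHausdorffMeasure (finrank ℝ E - 1))) w := by
  have hR : IsOpen {x ∈ U | fderiv ℝ ψ x ≠ 0} :=
    (hψ.continuousOn_fderiv_of_isOpen hU (by simp)).isOpen_inter_preimage hU isOpen_ne
  obtain ⟨g', hg', hgc', hgs', heq⟩ := exists_contDiff_eqOn_of_isCompact hR hQ hQR hg
  have hmeas := fun v => measurableSet_levelSet hU hψ.continuousOn v
  obtain ⟨h1, h2⟩ := contDiff_setIntegral_levelSet_of_tsupport_subset hU hψ hg' hgc' hgs'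
  refine ⟨(h1 w).congr_fun (heq.mono hev.self_of_nhds) (hmeas w),
    h2.contDiffAt.congr_of_eventuallyEq ?_⟩
  filter_upwards [hev] with v hv
  exact setIntegral_congr_fun (hmeas v) (heq.symm.mono hv)

theorem contDiffOn_setIntegral_levelSet {U : Set E} {ψ : E → ℝ} (hU : IsOpen U)
    (hψ : ContDiffOn ℝ ∞ ψ U) {g : E → ℝ} (hg : ContDiffOn ℝ ∞ g {x ∈ U | fderiv ℝ ψ x ≠ 0})
    {I : Set ℝ} (hI : ∀ w ∈ I, ∃ Q, IsCompact Q ∧ Q ⊆ {x ∈ U | fderiv ℝ ψ x ≠ 0} ∧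
      ∀ᶠ v in 𝓝 w, StructureIntegral.levelSet U ψ v ⊆ Q) :
    (∀ v ∈ I, IntegrableOn g (StructureIntegral.levelSet U ψ v)
        (Measure.euclideanHausdorffMeasure (finrank ℝ E - 1))) ∧
      ContDiffOn ℝ ∞ (fun v => ∫ x in StructureIntegral.levelSet U ψ v, g x
        ∂(Measure.euclideanHausdorffMeasure (finrank ℝ E - 1))) I := by
  have h := fun w hw =>
    let ⟨_, hQ, hQR, hev⟩ := hI w hw
    contDiffAt_setIntegral_levelSet hU hψ hg hQ hQR hev
  exact ⟨fun w hw => (h w hw).1, fun w hw => (h w hw).2.contDiffWithinAt⟩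

end LevelIntegrals

/-! ### A level set through a nondegenerate critical point is not a smooth retract. -/

section CriticalPoints

variable {E : Type*} [NormedAddCommGroup E] [NormedSpace ℝ E]

/-- Mean value inequality for `ψ (p + ζ) - B ζ ζ / 2`: its derivative `fderiv ℝ ψ (p + ζ) - B ζ` is
`o(ζ)` by differentiability of `fderiv ℝ ψ` at `p`. -/
theorem isLittleO_sub_half_fderiv_fderiv {ψ : E → ℝ} {p : E} (hψ : ContDiffAt ℝ 2 ψ p)
    (hp : fderiv ℝ ψ p = 0) :
    (fun ξ => ψ (p + ξ) - ψ p - 1 / 2 * fderiv ℝ (fderiv ℝ ψ) p ξ ξ) =o[𝓝 0]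
      fun ξ => ‖ξ‖ ^ 2 := by
  set B := fderiv ℝ (fderiv ℝ ψ) p with hB
  have hsymm : ∀ u w, B u w = B w u := fun u w =>
    (hψ.isSymmSndFDerivAt (by simp)) u w
  have hd : HasFDerivAt (fderiv ℝ ψ) B p :=
    ((hψ.fderiv_right (m := 1) (by norm_num)).differentiableAt (by simp)).hasFDerivAt
  have hdiff : ∀ᶠ x in 𝓝 p, DifferentiableAt ℝ ψ x :=
    (hψ.eventually (by simp)).mono fun x hx => hx.differentiableAt (by simp)
  refine Asymptotics.isLittleO_iff.2 fun ε hε => ?_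
  have h1 := (hasFDerivAt_iff_isLittleO_nhds_zero.1 hd).def hε
  have h2 : ∀ᶠ ξ in 𝓝 (0 : E), DifferentiableAt ℝ ψ (p + ξ) :=
    ((continuous_const_add p).tendsto' 0 p (add_zero p)).eventually hdiff
  obtain ⟨δ, hδ, hball⟩ := Metric.eventually_nhds_iff_ball.1 (h1.and h2)
  filter_upwards [Metric.ball_mem_nhds 0 hδ] with ξ hξ
  have hsub : ∀ ζ ∈ Metric.closedBall (0 : E) ‖ξ‖, ζ ∈ Metric.ball (0 : E) δ := fun ζ hζ => by
    rw [mem_ball_zero_iff] at hξ ⊢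
    rw [mem_closedBall_zero_iff] at hζ
    exact hζ.trans_lt hξ
  have hder : ∀ ζ ∈ Metric.closedBall (0 : E) ‖ξ‖,
      HasFDerivWithinAt (fun ζ => ψ (p + ζ) - 1 / 2 * B ζ ζ) (fderiv ℝ ψ (p + ζ) - B ζ)
        (Metric.closedBall (0 : E) ‖ξ‖) ζ := by
    intro ζ hζ
    have h3 : HasFDerivAt (fun ζ => ψ (p + ζ)) (fderiv ℝ ψ (p + ζ)) ζ :=
      
      (HasFDerivAt.comp (f := fun ζ => p + ζ) ζ (hball ζ (hsub ζ hζ)).2.hasFDerivAt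
        ((hasFDerivAt_id ζ).const_add p)).congr_fderiv (ContinuousLinearMap.comp_id _)
    have h4 : HasFDerivAt (fun ζ => B ζ ζ) _ ζ := (B.hasFDerivAt (x := ζ)).clm_apply
      (hasFDerivAt_id ζ)
    refine ((h3.sub (h4.const_mul (1 / 2 : ℝ))).congr_fderiv ?_).hasFDerivWithinAt
    ext u
    simp [hsymm u ζ]
    ring
  have hbound : ∀ ζ ∈ Metric.closedBall (0 : E) ‖ξ‖, ‖fderiv ℝ ψ (p + ζ) - B ζ‖ ≤ ε * ‖ξ‖ := by
    intro ζ hζ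
    have := (hball ζ (hsub ζ hζ)).1
    rw [hp, sub_zero] at this
    exact this.trans (mul_le_mul_of_nonneg_left (mem_closedBall_zero_iff.1 hζ) hε.le)
  have := (convex_closedBall (0 : E) ‖ξ‖).norm_image_sub_le_of_norm_hasFDerivWithin_le hder hbound
    (Metric.mem_closedBall_self (norm_nonneg _)) (y := ξ) (by simp)
  rw [norm_pow, norm_norm]
  calc _ = ‖ψ (p + ξ) - 1 / 2 * B ξ ξ - (ψ (p + 0) - 1 / 2 * B 0 0)‖ := by
        congr 1; simp; ring
    _ ≤ _ := this
    _ = _ := by simp; ring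

theorem tendsto_inv_sq_mul_sub_of_critical {ψ : E → ℝ} {p : E} (hψ : ContDiffAt ℝ 2 ψ p)
    (hp : fderiv ℝ ψ p = 0) {ξ : ℝ → E} {u : E}
    (hξ : Tendsto (fun t => t⁻¹ • ξ t) (𝓝[≠] 0) (𝓝 u)) :
    Tendsto (fun t => (t ^ 2)⁻¹ * (ψ (p + ξ t) - ψ p)) (𝓝[≠] 0)
      (𝓝 (1 / 2 * fderiv ℝ (fderiv ℝ ψ) p u u)) := by
  set B := fderiv ℝ (fderiv ℝ ψ) p
  have hne : ∀ᶠ t : ℝ in 𝓝[≠] 0, t ≠ 0 := eventually_mem_nhdsWithin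
  have ht0 : Tendsto (fun t : ℝ => t) (𝓝[≠] 0) (𝓝 0) := nhdsWithin_le_nhds
  have hξ0 : Tendsto ξ (𝓝[≠] 0) (𝓝 0) := by
    have := ht0.smul hξ
    rw [zero_smul] at this
    refine this.congr' ?_
    filter_upwards [hne] with t ht
    rw [smul_inv_smul₀ ht]
  have h1 := (isLittleO_sub_half_fderiv_fderiv hψ hp).comp_tendsto hξ0
  have h2 : (fun t => ‖ξ t‖ ^ 2) =O[𝓝[≠] 0] fun t : ℝ => t ^ 2 := by
    have h3 : (fun t => ξ t) =O[𝓝[≠] 0] fun t : ℝ => t := by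
      have := (Asymptotics.isBigO_refl (fun t : ℝ => t) (𝓝[≠] 0)).smul (hξ.isBigO_one ℝ)
      refine (this.congr' ?_ ?_)
      · filter_upwards [hne] with t ht
        rw [smul_inv_smul₀ ht]
      · simp
    exact h3.norm_left.pow 2
  have h4 := (h1.trans_isBigO h2).tendsto_div_nhds_zero
  have h5 : Tendsto (fun t => 1 / 2 * B (t⁻¹ • ξ t) (t⁻¹ • ξ t)) (𝓝[≠] 0)
      (𝓝 (1 / 2 * B u u)) :=
    ((by fun_prop : Continuous fun u : E => 1 / 2 * B u u).tendsto u).comp hξ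
  have h6 := h4.add h5
  rw [zero_add] at h6
  refine h6.congr' ?_
  filter_upwards [hne] with t ht
  simp only [Function.comp, map_smul, smul_apply, smul_eq_mul]
  field_simp
  ring

/-- The range of `M` is isotropic for the Hessian `B` and contains some `a ≠ 0`. Nondegeneracy
supplies an isotropic `w` with `B a w ≠ 0`, and the level has points `p + ξ`, `ξ = t (w + s a)`,
with `t` arbitrarily small. Being fixed by `ρ`, they satisfy `ξ - M ξ = o(t)`, yet `B a (ξ - M ξ) =
t B a w`. -/
theorem false_of_retraction_onto_level_of_nondegenerate {ψ : E → ℝ} {p : E}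
    (hψ : ContDiffAt ℝ 2 ψ p) (hp : fderiv ℝ ψ p = 0)
    (hnd : ∀ u, (∀ w, fderiv ℝ (fderiv ℝ ψ) p u w = 0) → u = 0) {ρ : E → E} {M : E →L[ℝ] E}
    (hρ : HasFDerivAt ρ M p) (hρp : ρ p = p) (hval : ∀ᶠ x in 𝓝 p, ψ (ρ x) = ψ p)
    (hfix : ∀ᶠ x in 𝓝 p, ψ x = ψ p → ρ x = x) (hacc : ∃ᶠ x in 𝓝[≠] p, ψ x = ψ p) : False := by
  set B := fderiv ℝ (fderiv ℝ ψ) p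
  have hsymm : ∀ u w, B u w = B w u := fun u w => (hψ.isSymmSndFDerivAt (by simp)) u w
  have hρo : (fun x => ρ x - p - M (x - p)) =o[𝓝 p] fun x => x - p := by
    simpa [hρp] using hasFDerivAt_iff_isLittleO.1 hρ
  have hiso : ∀ u, B (M u) (M u) = 0 := by
    intro u
    have h1 := (hρ.hasLineDerivAt u).tendsto_slope_zero
    simp only [hρp] at h1
    have h2 := tendsto_inv_sq_mul_sub_of_critical hψ hp h1
    have h3 : ∀ᶠ t : ℝ in 𝓝[≠] 0, (t ^ 2)⁻¹ * (ψ (p + (ρ (p + t • u) - p)) - ψ p) = 0 := by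
      have h4 : Tendsto (fun t : ℝ => p + t • u) (𝓝[≠] 0) (𝓝 p) := by
        have : ContinuousAt (fun t : ℝ => p + t • u) 0 := by fun_prop
        simpa [ContinuousAt] using this.tendsto.mono_left nhdsWithin_le_nhds
      filter_upwards [h4.eventually hval] with t ht
      rw [add_sub_cancel, ht, sub_self, mul_zero]
    have h5 := tendsto_nhds_unique (h2.congr' h3) tendsto_const_nhds
    linarith
  have hiso' : ∀ u u', B (M u) (M u') = 0 := by
    intro u u'
    have h := hiso (u + u')
    simp only [map_add, add_apply, hiso, hsymm (M u') (M u)] at h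
    linarith
  -- If `M = 0`, then fixed points `x` accumulating at `p` would satisfy `x - p = o(x - p)`.
  obtain ⟨u, hu⟩ : ∃ u, M u ≠ 0 := by
    by_contra! h
    have h1 := hρo.def (c := 1 / 2) (by norm_num)
    obtain ⟨x, ⟨⟨hx, hx1⟩, hxfix⟩, hxne⟩ :=
      ((hacc.and_eventually (h1.filter_mono nhdsWithin_le_nhds)).and_eventually
        (hfix.filter_mono nhdsWithin_le_nhds)).and_eventually eventually_mem_nhdsWithin |>.exists
    rw [h, sub_zero, hxfix hx] at hx1
    have : 0 < ‖x - p‖ := norm_pos_iff.2 (sub_ne_zero.2 hxne)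
    linarith
  set a := M u
  obtain ⟨n, hn⟩ : ∃ n, B a n ≠ 0 := by
    by_contra! h
    exact hu (hnd a h)
  set b := B a n
  -- The multiple of `a` is chosen to cancel `B n n`, which makes `w` isotropic; `B a w = b`
  -- survives because `a` is isotropic.
  set w := n - (B n n / (2 * b)) • a with hw
  have haa : B a a = 0 := hiso u
  have haw : B a w = b := by simp [hw, haa, b]
  have hww : B w w = 0 := by
    have hna : B n a = b := hsymm n a
    simp only [hw, map_sub, map_smul, sub_apply,
      smul_apply, smul_eq_mul, hna, haa]
    change B n n - B n n / (2 * b) * b - B n n / (2 * b) * (b - B n n / (2 * b) * 0) = 0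
    field_simp
    ring
  have hline : ∀ ξ : E, Tendsto (fun t : ℝ => (t ^ 2)⁻¹ * (ψ (p + t • ξ) - ψ p)) (𝓝[≠] 0)
      (𝓝 (1 / 2 * B ξ ξ)) := fun ξ => by
    refine tendsto_inv_sq_mul_sub_of_critical hψ hp (tendsto_const_nhds.congr' ?_)
    filter_upwards [eventually_mem_nhdsWithin] with t ht
    rw [inv_smul_smul₀ ht]
  have hplus : 1 / 2 * B (w + a) (w + a) = b := by
    simp [hww, haa, haw, hsymm w a]; ring
  have hminus : 1 / 2 * B (w - a) (w - a) = -b := by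
    simp [hww, haa, haw, hsymm w a]; ring
  have hprod := (hline (w + a)).mul (hline (w - a))
  rw [hplus, hminus] at hprod
  have hneg : ∀ᶠ t : ℝ in 𝓝[≠] 0,
      (ψ (p + t • (w + a)) - ψ p) * (ψ (p + t • (w - a)) - ψ p) < 0 := by
    filter_upwards [hprod.eventually (gt_mem_nhds (show b * -b < 0 by
      have := mul_self_pos.2 hn; change b * -b < 0; linarith)),
      eventually_mem_nhdsWithin] with t ht ht0
    have h1 : 0 < (t ^ 2)⁻¹ * (t ^ 2)⁻¹ := by
      have : t ≠ 0 := ht0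
      positivity
    by_contra! hge
    have := mul_nonneg h1.le hge
    linarith
  obtain ⟨δ, hδ, hball⟩ := Metric.eventually_nhds_iff_ball.1
    ((hψ.eventually (by simp)).mono fun x hx => hx.continuousAt)
  set R := ‖w‖ + ‖a‖
  have hR : 0 < R := add_pos_of_nonneg_of_pos (norm_nonneg _) (norm_pos_iff.2 hu)
  -- Chosen so that `‖B a‖ * ε * R < |b|`; the `+ 1` only keeps the denominator visibly positive.
  set ε : ℝ := |b| / (2 * (‖B a‖ + 1) * R)
  have hbpos : 0 < |b| := abs_pos.2 hn
  have hBa : 0 < ‖B a‖ + 1 := by positivity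
  have hε : 0 < ε := by positivity
  obtain ⟨δ', hδ', hball'⟩ := Metric.eventually_nhds_iff_ball.1 ((hρo.def hε).and hfix)
  have hsmall : ∀ᶠ t : ℝ in 𝓝[>] 0, t * R < min δ δ' := by
    have : ContinuousAt (fun t : ℝ => t * R) 0 := by fun_prop
    refine (this.eventually (gt_mem_nhds ?_)).filter_mono nhdsWithin_le_nhds
    simpa using ⟨hδ, hδ'⟩
  obtain ⟨t, ⟨ht, htneg⟩, ht0⟩ := ((hsmall.and
    (hneg.filter_mono (nhdsWithin_mono _ fun t (ht : 0 < t) => ht.ne'))).and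
      eventually_mem_nhdsWithin).exists
  have ht0 : 0 < t := ht0
  have hnorm : ∀ s ∈ Icc (-1 : ℝ) 1, ‖t • (w + s • a)‖ ≤ t * R := by
    intro s hs
    rw [norm_smul, Real.norm_of_nonneg ht0.le]
    refine mul_le_mul_of_nonneg_left ((norm_add_le _ _).trans ?_) ht0.le
    rw [norm_smul]
    have : |s| ≤ 1 := abs_le.2 hs
    have := mul_le_mul_of_nonneg_right this (norm_nonneg a)
    simpa [R] using this
  have hcont : ContinuousOn (fun s : ℝ => ψ (p + t • (w + s • a)) - ψ p) (Icc (-1) 1) := by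
    intro s hs
    have hmem : p + t • (w + s • a) ∈ Metric.ball p δ := by
      rw [mem_ball_iff_norm, add_sub_cancel_left]
      exact (hnorm s hs).trans_lt (ht.trans_le (min_le_left _ _))
    have h1 : ContinuousAt (fun s : ℝ => p + t • (w + s • a)) s := by fun_prop
    exact ((ContinuousAt.comp (f := fun s : ℝ => p + t • (w + s • a)) (hball _ hmem) h1).sub
      continuousAt_const).continuousWithinAt
  -- The increments of `ψ` along `w + a` and `w - a` have opposite signs, to second order `±t² b`,
  -- so the segment between them meets the level.
  obtain ⟨s, hs, hs0⟩ : ∃ s ∈ Icc (-1 : ℝ) 1, ψ (p + t • (w + s • a)) - ψ p = 0 := by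
    have e1 : w + (1 : ℝ) • a = w + a := by simp
    have e2 : w + (-1 : ℝ) • a = w - a := by simp [sub_eq_add_neg]
    rcases mul_neg_iff.1 htneg with ⟨h1, h2⟩ | ⟨h1, h2⟩
    · obtain ⟨s, hs, h⟩ := intermediate_value_Icc (by norm_num) hcont
        (show (0 : ℝ) ∈ _ from ⟨by rw [e2]; exact h2.le, by rw [e1]; exact h1.le⟩)
      exact ⟨s, hs, h⟩
    · obtain ⟨s, hs, h⟩ := intermediate_value_Icc' (by norm_num) hcont
        (show (0 : ℝ) ∈ _ from ⟨by rw [e1]; exact h1.le, by rw [e2]; exact h2.le⟩)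
      exact ⟨s, hs, h⟩
  have hxmem : p + t • (w + s • a) ∈ Metric.ball p δ' := by
    rw [mem_ball_iff_norm, add_sub_cancel_left]
    exact (hnorm s hs).trans_lt (ht.trans_le (min_le_right _ _))
  obtain ⟨h1, h2⟩ := hball' _ hxmem
  rw [h2 (sub_eq_zero.1 hs0), add_sub_cancel_left] at h1
  set ξ := t • (w + s • a)
  have hBξ : B a (ξ - M ξ) = t * b := by
    rw [map_sub, hiso' u ξ]
    simp [ξ, haw, haa]
  have h3 : t * |b| ≤ ‖B a‖ * (ε * (t * R)) := by
    calc t * |b| = ‖B a (ξ - M ξ)‖ := by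
          rw [hBξ, Real.norm_eq_abs, abs_mul, abs_of_pos ht0]
      _ ≤ ‖B a‖ * ‖ξ - M ξ‖ := (B a).le_opNorm _
      _ ≤ _ := by
          refine mul_le_mul_of_nonneg_left (h1.trans ?_) (norm_nonneg _)
          exact mul_le_mul_of_nonneg_left (hnorm s hs) hε.le
  have h4 : ‖B a‖ * (ε * (t * R)) = t * |b| * (‖B a‖ / (2 * (‖B a‖ + 1))) := by
    simp only [ε]; field_simp
  have h5 : ‖B a‖ / (2 * (‖B a‖ + 1)) < 1 := by
    rw [div_lt_one (by positivity)]; linarith [norm_nonneg (B a)]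
  have h6 : 0 < t * |b| := by positivity
  nlinarith

end CriticalPoints

/-! ### Regularity of all levels in the open interval. -/

section CriticalPoints

variable {E : Type*} [NormedAddCommGroup E] [NormedSpace ℝ E]

theorem StructureIntegral.SmoothOnSubset.continuousOn {F : Type*} [NormedAddCommGroup F]
    [NormedSpace ℝ F] {f : E → F} {A : Set E} (hf : StructureIntegral.SmoothOnSubset f A) :
    ContinuousOn f A := by
  intro x hx
  obtain ⟨O, g, hO, hxO, hg, hfg⟩ := hf x hx
  have h1 : ContinuousWithinAt g A x :=
    (hg.continuousOn.continuousAt (hO.mem_nhds hxO)).continuousWithinAt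
  refine h1.congr_of_eventuallyEq ?_ (hfg ⟨hx, hxO⟩)
  filter_upwards [self_mem_nhdsWithin, mem_nhdsWithin_of_mem_nhds (hO.mem_nhds hxO)] with y h1 h2
  exact hfg ⟨h1, h2⟩

theorem eventually_fderiv_ne_zero_of_nondegenerate [FiniteDimensional ℝ E] {ψ : E → ℝ} {p : E}
    (hψ : ContDiffAt ℝ 2 ψ p)
    (hnd : ∀ u, (∀ w, fderiv ℝ (fderiv ℝ ψ) p u w = 0) → u = 0) :
    ∀ᶠ x in 𝓝[≠] p, fderiv ℝ ψ x ≠ 0 := by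
  have hd : HasFDerivAt (fderiv ℝ ψ) (fderiv ℝ (fderiv ℝ ψ) p) p :=
    ((hψ.fderiv_right (m := 1) (by norm_num)).differentiableAt (by simp)).hasFDerivAt
  refine hd.eventually_ne ?_
  obtain ⟨K, -, hK⟩ := ((fderiv ℝ (fderiv ℝ ψ) p : E →L[ℝ] E →L[ℝ] ℝ) :
    E →ₗ[ℝ] E →L[ℝ] ℝ).exists_antilipschitzWith
      (LinearMap.ker_eq_bot'.2 fun u hu => hnd u fun w => DFunLike.congr_fun hu w)
  exact ⟨K, hK⟩

/-- Nondegenerate critical points are isolated, and a discrete subspace of a second countable space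
is countable. -/
theorem countable_setOf_critical_of_morseOn [FiniteDimensional ℝ E] {U S : Set E} {ψ : E → ℝ}
    (hU : IsOpen U) (hψ : ContDiffOn ℝ ∞ ψ U) (hS : S ⊆ U)
    (hM : StructureIntegral.MorseOn ψ S) : {x ∈ S | fderiv ℝ ψ x = 0}.Countable := by
  have : DiscreteTopology {x ∈ S | fderiv ℝ ψ x = 0} := by
    refine discreteTopology_subtype_iff.2 fun x hx => ?_
    rw [← disjoint_iff, disjoint_principal_right]
    have h2 : ContDiffAt ℝ 2 ψ x :=
      (hψ.contDiffAt (hU.mem_nhds (hS hx.1))).of_le (WithTop.coe_le_coe.2 (le_top (a := (2 : ℕ∞))))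
    filter_upwards [eventually_fderiv_ne_zero_of_nondegenerate h2 (hM x hx.1 hx.2)] with y hy h
    exact hy h.2
  exact (HereditarilyLindelofSpace.isLindelof _).countable this

theorem exists_mem_Ioo_forall_levelSet_fderiv_ne_zero [FiniteDimensional ℝ E] {U : Set E}
    {ψ : E → ℝ} {v₀ v₁ : ℝ} (hU : IsOpen U) (hψ : ContDiffOn ℝ ∞ ψ U)
    (hM : StructureIntegral.MorseOn ψ {x ∈ U | v₀ ≤ ψ x ∧ ψ x ≤ v₁}) (hv : v₀ < v₁) :
    ∃ v ∈ Ioo v₀ v₁, ∀ x ∈ StructureIntegral.levelSet U ψ v, fderiv ℝ ψ x ≠ 0 := by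
  have hc := (countable_setOf_critical_of_morseOn hU hψ (fun x hx => hx.1) hM).image ψ
  obtain ⟨v, hv, hvI⟩ := (hc.dense_compl ℝ).exists_mem_open isOpen_Ioo (nonempty_Ioo.2 hv)
  refine ⟨v, hvI, fun x hx h0 => hv ⟨x, ⟨⟨hx.1, ?_, ?_⟩, h0⟩, hx.2⟩⟩
  · rw [hx.2]; exact hvI.1.le
  · rw [hx.2]; exact hvI.2.le

end CriticalPoints

section CriticalPoints

variable {E : Type*} [NormedAddCommGroup E] [InnerProductSpace ℝ E] [FiniteDimensional ℝ E]

/-- Regularity is carried from level `v'` to level `v` by transporting the chart projection through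
the diffeomorphism, which retracts a neighbourhood of `p` onto level `v`. Dimension at least `2`
excludes a nondegenerate extremum that is an isolated point of its level. -/
theorem fderiv_ne_zero_of_diffeomorphicSubsets_regular {U : Set E} {ψ : E → ℝ} {v v' : ℝ}
    (hE : 2 ≤ finrank ℝ E) (hU : IsOpen U) (hψ : ContDiffOn ℝ ∞ ψ U)
    (hreg : ∀ x ∈ StructureIntegral.levelSet U ψ v', fderiv ℝ ψ x ≠ 0)
    (hdiff : StructureIntegral.DiffeomorphicSubsets (StructureIntegral.levelSet U ψ v')
      (StructureIntegral.levelSet U ψ v)) {p : E} (hp : p ∈ StructureIntegral.levelSet U ψ v)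
    (hnd : fderiv ℝ ψ p = 0 → ∀ u, (∀ w, fderiv ℝ (fderiv ℝ ψ) p u w = 0) → u = 0) :
    fderiv ℝ ψ p ≠ 0 := by
  intro hp0
  obtain ⟨f, h, hf, hh, hfm, hhm, hleft, hright⟩ := hdiff
  set A := StructureIntegral.levelSet U ψ v'
  set q := h p
  have hq : q ∈ A := hhm hp
  have hfq : f q = p := hright hp
  obtain ⟨H, e, hdim, hqe, heU, he, hes⟩ := exists_chart_of_fderiv_ne_zero hU hψ hq.1 (hreg q hq)
  set π := H.orthogonalProjectionOnto
  have heq : e q = (v', π q) := by rw [he, hq.2]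
  have htq : (v', π q) ∈ e.target := heq ▸ e.map_source hqe
  have hsymmq : e.symm (v', π q) = q := by rw [← heq, e.left_inv hqe]
  obtain ⟨Of, f', hOf, hqOf, hf', hff'⟩ := hf q hq
  obtain ⟨Oh, h', hOh, hpOh, hh', hhh'⟩ := hh p hp
  have hh'p : h' p = q := (hhh' ⟨hp, hpOh⟩).symm
  have hf'q : f' q = p := (hff' ⟨hq, hqOf⟩).symm.trans hfq
  have hsat : ContDiffAt ℝ ∞ e.symm (v', π q) := hes.contDiffAt (e.open_target.mem_nhds htq)
  set σ : H → E := fun y => e.symm (v', y)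
  have hσq : σ (π q) = q := hsymmq
  have hσd : ContDiffAt ℝ ∞ σ (π q) :=
    hsat.comp (f := fun y : H => (v', y)) (π q) (by fun_prop)
  have hσmem : ∀ᶠ y in 𝓝 (π q), (v', y) ∈ e.target :=
    (by fun_prop : Continuous fun y : H => (v', y)).continuousAt.eventually
      (e.open_target.mem_nhds htq)
  have hσA : ∀ y, (v', y) ∈ e.target → σ y ∈ A ∧ π (σ y) = y := fun y hy => by
    have h1 := (he (σ y)).symm.trans (e.right_inv hy)
    exact ⟨⟨heU (e.map_target hy), congrArg Prod.fst h1⟩, congrArg Prod.snd h1⟩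
  have hσOf : ∀ᶠ y in 𝓝 (π q), σ y ∈ Of :=
    hσd.continuousAt.eventually (by rw [hσq]; exact hOf.mem_nhds hqOf)
  -- Ambient extension of the inverse diffeomorphism, then projection to level `v'` along the chart,
  -- then the diffeomorphism back.
  set ρ : E → E := fun x => f' (σ (π (h' x)))
  have hh'd : ContDiffAt ℝ ∞ h' p := hh'.contDiffAt (hOh.mem_nhds hpOh)
  have hf'd : ContDiffAt ℝ ∞ f' q := hf'.contDiffAt (hOf.mem_nhds hqOf)
  have hπh : ContDiffAt ℝ ∞ (fun x => π (h' x)) p := π.contDiff.contDiffAt.comp p hh'd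
  have hπh_tendsto : Tendsto (fun x => π (h' x)) (𝓝 p) (𝓝 (π q)) := by
    simpa [ContinuousAt, hh'p] using hπh.continuousAt
  have hσh : ContDiffAt ℝ ∞ (fun x => σ (π (h' x))) p :=
    ContDiffAt.comp (g := σ) p (by rw [hh'p]; exact hσd) hπh
  have hρd : ContDiffAt ℝ ∞ ρ p :=
    ContDiffAt.comp (g := f') p (by rw [hh'p, hσq]; exact hf'd) hσh
  have hρA : ∀ᶠ x in 𝓝 p, ψ (ρ x) = ψ p := by
    filter_upwards [hπh_tendsto.eventually hσmem, hπh_tendsto.eventually hσOf] with x h1 h2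
    have h3 := (hσA _ h1).1
    change ψ (f' (σ (π (h' x)))) = ψ p
    rw [← hff' ⟨h3, h2⟩, (hfm h3).2, hp.2]
  have hfix : ∀ᶠ x in 𝓝 p, ψ x = ψ p → ρ x = x := by
    have hsrc : ∀ᶠ x in 𝓝 p, h' x ∈ e.source ∩ Of :=
      hh'd.continuousAt.eventually (by
        rw [hh'p]; exact (e.open_source.inter hOf).mem_nhds ⟨hqe, hqOf⟩)
    filter_upwards [hsrc, hU.mem_nhds hp.1, hOh.mem_nhds hpOh] with x h1 h2 h3 h4
    have hxB : x ∈ StructureIntegral.levelSet U ψ v := ⟨h2, h4.trans hp.2⟩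
    have h5 : h' x = h x := (hhh' ⟨hxB, h3⟩).symm
    have h6 : h x ∈ A := hhm hxB
    rw [h5] at h1
    have h7 : σ (π (h x)) = h x := by
      have : e (h x) = (v', π (h x)) := by rw [he, h6.2]
      change e.symm (v', π (h x)) = h x
      rw [← this, e.left_inv h1.1]
    change f' (σ (π (h' x))) = x
    rw [h5, h7, ← hff' ⟨h6, h1.2⟩]
    exact hright hxB
  -- The regular level has positive dimension, so `q` is not isolated in it; the injective `f`
  -- carries this to `p`.
  have hacc : ∃ᶠ x in 𝓝[≠] p, ψ x = ψ p := by
    have : Nontrivial H := nontrivial_of_finrank_pos (R := ℝ) (by omega)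
    have htend : Tendsto (fun y => f' (σ y)) (𝓝 (π q)) (𝓝 p) := by
      have h1 : ContDiffAt ℝ ∞ (fun y => f' (σ y)) (π q) :=
        ContDiffAt.comp (g := f') _ (by rw [hσq]; exact hf'd) hσd
      simpa [ContinuousAt, hσq, hf'q] using h1.continuousAt
    have hgood : ∀ᶠ y in 𝓝[≠] (π q), f' (σ y) ≠ p ∧ ψ (f' (σ y)) = ψ p := by
      filter_upwards [nhdsWithin_le_nhds hσmem, nhdsWithin_le_nhds hσOf,
        eventually_mem_nhdsWithin] with y h1 h2 h3
      obtain ⟨h4, h5⟩ := hσA y h1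
      rw [← hff' ⟨h4, h2⟩, (hfm h4).2, hp.2]
      refine ⟨fun h6 => h3 ?_, rfl⟩
      have h7 := hleft h4
      rw [h6] at h7
      change y = π q
      rw [← h5, ← h7]
    have htend' : Tendsto (fun y => f' (σ y)) (𝓝[≠] (π q)) (𝓝[≠] p) :=
      tendsto_nhdsWithin_iff.2 ⟨htend.mono_left nhdsWithin_le_nhds, hgood.mono fun y hy => hy.1⟩
    exact htend'.frequently (hgood.mono fun y hy => hy.2).frequently
  refine false_of_retraction_onto_level_of_nondegenerate
    ((hψ.contDiffAt (hU.mem_nhds hp.1)).of_le (WithTop.coe_le_coe.2 (le_top (a := (2 : ℕ∞))))) hp0 (hnd hp0)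
    (hρd.differentiableAt (by simp)).hasFDerivAt ?_ hρA hfix hacc
  change f' (σ (π (h' p))) = p
  rw [hh'p, hσq, hf'q]

theorem fderiv_ne_zero_of_morseOn_of_diffeomorphicSubsets {U : Set E} {ψ : E → ℝ} {v₀ v₁ : ℝ}
    (hE : 2 ≤ finrank ℝ E) (hU : IsOpen U) (hψ : ContDiffOn ℝ ∞ ψ U)
    (hM : StructureIntegral.MorseOn ψ {x ∈ U | v₀ ≤ ψ x ∧ ψ x ≤ v₁})
    (hdiff : ∀ v ∈ Icc v₀ v₁, ∀ v' ∈ Icc v₀ v₁, StructureIntegral.DiffeomorphicSubsets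
      (StructureIntegral.levelSet U ψ v) (StructureIntegral.levelSet U ψ v'))
    {v : ℝ} (hv : v ∈ Ioo v₀ v₁) :
    ∀ x ∈ StructureIntegral.levelSet U ψ v, fderiv ℝ ψ x ≠ 0 := by
  obtain ⟨v', hv', hreg⟩ :=
    exists_mem_Ioo_forall_levelSet_fderiv_ne_zero hU hψ hM (hv.1.trans hv.2)
  intro x hx
  refine fderiv_ne_zero_of_diffeomorphicSubsets_regular hE hU hψ hreg
    (hdiff v' (Ioo_subset_Icc_self hv') v (Ioo_subset_Icc_self hv)) hx (hM x ⟨hx.1, ?_⟩)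
  rw [hx.2]
  exact ⟨hv.1.le, hv.2.le⟩

end CriticalPoints

/-! ### Counting clopen pieces, and why nearby levels cannot escape. -/

section Pieces

/-- The subset `S` is a disjoint union of `m` nonempty relatively clopen pieces. -/
def HasClopenPieces {X : Type*} [TopologicalSpace X] (S : Set X) (m : ℕ) : Prop :=
  ∃ f : X → ℕ, ContinuousOn f S ∧ f '' S = Iio m

variable {X Y : Type*} [TopologicalSpace X] [TopologicalSpace Y]

theorem HasClopenPieces.of_continuousOn {A : Set X} {B : Set Y} {m : ℕ}
    (hA : HasClopenPieces A m) {h : Y → X} (hh : ContinuousOn h B) (hBA : h '' B = A) :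
    HasClopenPieces B m := by
  obtain ⟨f, hf, hfA⟩ := hA
  refine ⟨f ∘ h, hf.comp hh (hBA ▸ mapsTo_image h B), ?_⟩
  rw [image_comp, hBA, hfA]

theorem exists_hasClopenPieces (S : Set X) : ∃ m, HasClopenPieces S m := by
  rcases S.eq_empty_or_nonempty with rfl | hS
  · exact ⟨0, fun _ => 0, continuousOn_const, by simp⟩
  · refine ⟨1, fun _ => 0, continuousOn_const, ?_⟩
    rw [hS.image_const]
    ext; simp

/-- A continuous `ℕ`-valued colouring is constant on each connected neighbourhood, so a finite cover
by them bounds the number of colours. -/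
theorem IsCompact.bddAbove_hasClopenPieces {S : Set X} (hS : IsCompact S)
    (hloc : ∀ p ∈ S, ∃ t ∈ 𝓝[S] p, t ⊆ S ∧ IsPreconnected t) :
    BddAbove {m | HasClopenPieces S m} := by
  choose! t ht htS htc using hloc
  obtain ⟨s, hsS, hcov⟩ := hS.elim_nhdsWithin_subcover t ht
  refine ⟨s.card, ?_⟩
  rintro m ⟨f, hf, hfS⟩
  have hsub : Iio m ⊆ (s.image f : Finset ℕ) := by
    rw [← hfS]
    rintro _ ⟨x, hx, rfl⟩
    obtain ⟨p, hp, hxp⟩ := mem_iUnion₂.1 (hcov hx)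
    have hpS := hsS p hp
    rw [(htc p hpS).constant (hf.mono (htS p hpS)) hxp (mem_of_mem_nhdsWithin hpS (ht p hpS))]
    exact Finset.mem_coe.2 (Finset.mem_image_of_mem f hp)
  have hsub' : Finset.range m ⊆ s.image f := fun i hi => by
    simpa using hsub (Finset.mem_range.1 hi)
  simpa using (Finset.card_le_card hsub').trans Finset.card_image_le

end Pieces

section Escape

variable {X : Type*} [TopologicalSpace X] [NormalSpace X] [T2Space X]

/-- If the level set at `w` has `m` clopen pieces, then a nearby level set not contained in a given
compact neighbourhood of it has `m + 1` pieces. -/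
theorem eventually_levelSet_subset_or_hasClopenPieces {U Q : Set X} {ψ : X → ℝ} {w : ℝ} {m : ℕ}
    (hψ : ContinuousOn ψ U) (hQ : IsCompact Q) (hQU : Q ⊆ U)
    (hc : IsCompact (StructureIntegral.levelSet U ψ w))
    (hSQ : StructureIntegral.levelSet U ψ w ⊆ interior Q)
    (hopen : ∀ p ∈ StructureIntegral.levelSet U ψ w, 𝓝 w ≤ map ψ (𝓝 p))
    (hm : HasClopenPieces (StructureIntegral.levelSet U ψ w) m) :
    ∀ᶠ v in 𝓝 w, StructureIntegral.levelSet U ψ v ⊆ Q ∨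
      HasClopenPieces (StructureIntegral.levelSet U ψ v) (m + 1) := by
  obtain ⟨f, hf, hfS⟩ := hm
  have hf' : ContinuousOn (fun x => (f x : ℝ)) (StructureIntegral.levelSet U ψ w) :=
    continuous_of_discreteTopology.comp_continuousOn hf
  -- Tietze extension of the colouring; near level `w` rounding `F` recovers the colours.
  obtain ⟨F, hF⟩ := ContinuousMap.exists_restrict_eq hc.isClosed
    ⟨_, continuousOn_iff_continuous_domRestrict.1 hf'⟩
  have hFf : ∀ x ∈ StructureIntegral.levelSet U ψ w, F x = f x := fun x hx =>
    DFunLike.congr_fun hF ⟨x, hx⟩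
  set N : ℕ → Set X := fun j => interior Q ∩ {x | |F x - j| < 1 / 2}
  have hNo : ∀ j, IsOpen (N j) := fun j =>
    isOpen_interior.inter (isOpen_lt (by fun_prop) continuous_const)
  have hfloor : ∀ j, ∀ x ∈ N j, ⌊F x + 1 / 2⌋₊ = j := by
    rintro j x ⟨-, hx⟩
    obtain ⟨h1, h2⟩ := abs_lt.1 (show |F x - j| < 1 / 2 from hx)
    have : (0 : ℝ) ≤ j := j.cast_nonneg
    exact (Nat.floor_eq_iff (by linarith)).2 ⟨by linarith, by linarith⟩
  -- `B` is compact and misses level `w`, so it misses all nearby levels: within `Q` these lie in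
  -- the coloured sets `N j`.
  set B : Set X := Q \ ⋃ j ∈ Iio m, N j
  have hB : IsCompact B := hQ.diff (isOpen_biUnion fun j _ => hNo j)
  have hBw : w ∉ ψ '' B := by
    rintro ⟨x, hx, hxw⟩
    have hxS : x ∈ StructureIntegral.levelSet U ψ w := ⟨hQU hx.1, hxw⟩
    have hfm : f x ∈ Iio m := hfS ▸ mem_image_of_mem f hxS
    refine hx.2 (mem_biUnion hfm ⟨hSQ hxS, ?_⟩)
    simp [hFf x hxS]
  have hBv : ∀ᶠ v in 𝓝 w, v ∉ ψ '' B :=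
    (hB.image_of_continuousOn (hψ.mono (sdiff_subset.trans hQU))).isClosed.isOpen_compl.mem_nhds hBw
  have hN : ∀ᶠ v in 𝓝 w, ∀ j ∈ Finset.range m, ∃ x ∈ N j, ψ x = v := by
    refine (Filter.eventually_all_finset _).2 fun j hj => ?_
    obtain ⟨p, hp, hpj⟩ : j ∈ f '' StructureIntegral.levelSet U ψ w := by
      rw [hfS]; exact Finset.mem_range.1 hj
    have hpN : N j ∈ 𝓝 p := (hNo j).mem_nhds ⟨hSQ hp, by simp [hFf p hp, hpj]⟩
    exact hopen p hp (image_mem_map hpN)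
  filter_upwards [hBv, hN] with v hv hNv
  refine or_iff_not_imp_left.2 fun hnot => ?_
  obtain ⟨x₀, hx₀, hx₀Q⟩ := not_subset.1 hnot
  classical
  have hcase : ∀ x ∈ StructureIntegral.levelSet U ψ v, x ∈ Q → ∃ j < m, x ∈ N j := by
    intro x hx hxQ
    by_contra hcon
    refine hv ⟨x, ⟨hxQ, fun hmem => hcon ?_⟩, hx.2⟩
    simpa using hmem
  -- The part outside `Q` gets the new colour `m`. On level `v`, points of `Q` lie in some `N j ⊆
  -- interior Q`, so the colouring is locally constant there.
  set fv : X → ℕ := fun x => if x ∈ interior Q then ⌊F x + 1 / 2⌋₊ else m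
  have hfvN : ∀ j, ∀ x ∈ N j, fv x = j := fun j x hx => by
    simp only [fv, if_pos hx.1, hfloor j x hx]
  have hfvQ : ∀ x, x ∉ Q → fv x = m := fun x hx => if_neg fun h => hx (interior_subset h)
  refine ⟨fv, fun x hx => ContinuousAt.continuousWithinAt ?_, ?_⟩
  · by_cases hxQ : x ∈ Q
    · obtain ⟨j, -, hj⟩ := hcase x hx hxQ
      refine (continuousAt_const (y := j)).congr ?_
      filter_upwards [(hNo j).mem_nhds hj] with y hy
      exact (hfvN j y hy).symm
    · refine (continuousAt_const (y := m)).congr ?_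
      filter_upwards [hQ.isClosed.isOpen_compl.mem_nhds hxQ] with y hy
      exact (hfvQ y hy).symm
  · ext i
    constructor
    · rintro ⟨x, hx, rfl⟩
      by_cases hxQ : x ∈ Q
      · obtain ⟨j, hjm, hj⟩ := hcase x hx hxQ
        rw [hfvN j x hj]
        exact Nat.lt_succ_of_lt hjm
      · rw [hfvQ x hxQ]
        exact Nat.lt_succ_self m
    · intro hi
      rcases Nat.lt_succ_iff_lt_or_eq.1 hi with hi | rfl
      · obtain ⟨x, hx, hxv⟩ := hNv i (Finset.mem_range.2 hi)
        exact ⟨x, ⟨hQU (interior_subset hx.1), hxv⟩, hfvN i x hx⟩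
      · exact ⟨x₀, hx₀, hfvQ x₀ hx₀Q⟩

end Escape

section LevelSets

variable {E : Type*} [NormedAddCommGroup E] [InnerProductSpace ℝ E] [FiniteDimensional ℝ E]

theorem exists_isPreconnected_mem_nhdsWithin_levelSet {U : Set E} {ψ : E → ℝ} {w : ℝ}
    (hU : IsOpen U) (hψ : ContDiffOn ℝ ∞ ψ U) {p : E}
    (hp : p ∈ StructureIntegral.levelSet U ψ w) (hreg : fderiv ℝ ψ p ≠ 0) :
    ∃ t ∈ 𝓝[StructureIntegral.levelSet U ψ w] p,
      t ⊆ StructureIntegral.levelSet U ψ w ∧ IsPreconnected t := by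
  obtain ⟨H, e, hdim, hpe, heU, he, hes⟩ := exists_chart_of_fderiv_ne_zero hU hψ hp.1 hreg
  set π := H.orthogonalProjectionOnto
  have hep : e p = (w, π p) := by rw [he, hp.2]
  have hT : {y : H | (w, y) ∈ e.target} ∈ 𝓝 (π p) :=
    (e.open_target.preimage (by fun_prop : Continuous fun y : H => (w, y))).mem_nhds
      (show (w, π p) ∈ e.target from hep ▸ e.map_source hpe)
  obtain ⟨ε, hε, hball⟩ := Metric.mem_nhds_iff.1 hT
  refine ⟨(fun y => e.symm (w, y)) '' Metric.ball (π p) ε, ?_, ?_, ?_⟩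
  · filter_upwards [self_mem_nhdsWithin, nhdsWithin_le_nhds (e.open_source.mem_nhds hpe),
      nhdsWithin_le_nhds (π.continuous.continuousAt.preimage_mem_nhds
        (Metric.ball_mem_nhds (π p) hε))] with x hx hxs hxb
    refine ⟨π x, hxb, ?_⟩
    change e.symm (w, π x) = x
    rw [← hx.2, ← he x, e.left_inv hxs]
  · rintro _ ⟨y, hy, rfl⟩
    have h1 := (he _).symm.trans (e.right_inv (hball hy))
    exact ⟨heU (e.map_target (hball hy)), congrArg Prod.fst h1⟩
  · refine (convex_ball (π p) ε).isPreconnected.image _ ?_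
    exact hes.continuousOn.comp (by fun_prop : Continuous fun y : H => (w, y)).continuousOn hball

/-- Take `m` maximal for level `w`: a nearby level leaving `Q` would have `m + 1` pieces, and the
diffeomorphism would pull them back to level `w`. -/
theorem exists_isCompact_eventually_levelSet_subset {U : Set E} {ψ : E → ℝ} {w : ℝ}
    (hU : IsOpen U) (hψ : ContDiffOn ℝ ∞ ψ U)
    (hc : IsCompact (StructureIntegral.levelSet U ψ w))
    (hreg : ∀ x ∈ StructureIntegral.levelSet U ψ w, fderiv ℝ ψ x ≠ 0)
    (hdiff : ∀ᶠ v in 𝓝 w, StructureIntegral.DiffeomorphicSubsets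
      (StructureIntegral.levelSet U ψ w) (StructureIntegral.levelSet U ψ v)) :
    ∃ Q, IsCompact Q ∧ Q ⊆ {x ∈ U | fderiv ℝ ψ x ≠ 0} ∧
      ∀ᶠ v in 𝓝 w, StructureIntegral.levelSet U ψ v ⊆ Q := by
  have hR : IsOpen {x ∈ U | fderiv ℝ ψ x ≠ 0} :=
    (hψ.continuousOn_fderiv_of_isOpen hU (by simp)).isOpen_inter_preimage hU isOpen_ne
  obtain ⟨Q, hQ, hSQ, hQR⟩ := exists_compact_between hc hR fun x hx => ⟨hx.1, hreg x hx⟩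
  refine ⟨Q, hQ, hQR, ?_⟩
  have hbdd := hc.bddAbove_hasClopenPieces fun p hp =>
    exists_isPreconnected_mem_nhdsWithin_levelSet hU hψ hp (hreg p hp)
  have hmax := Nat.sSup_mem (exists_hasClopenPieces (StructureIntegral.levelSet U ψ w)) hbdd
  have hopen : ∀ p ∈ StructureIntegral.levelSet U ψ w, 𝓝 w ≤ map ψ (𝓝 p) := by
    intro p hp
    have hs : HasStrictFDerivAt ψ (fderiv ℝ ψ p) p :=
      (hψ.contDiffAt (hU.mem_nhds hp.1)).hasStrictFDerivAt (by simp)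
    rw [hs.map_nhds_eq_of_surj (LinearMap.range_eq_top.2
      (LinearMap.surjective fun h => hreg p hp (ContinuousLinearMap.coe_injective h))), hp.2]
  filter_upwards [hdiff, eventually_levelSet_subset_or_hasClopenPieces hψ.continuousOn hQ
    (fun x hx => (hQR hx).1) hc hSQ hopen hmax] with v hv hor
  refine hor.resolve_right fun hpieces => ?_
  obtain ⟨f, h, hf, hh, hfm, hhm, hleft, hright⟩ := hv
  have := le_csSup hbdd (hpieces.of_continuousOn hf.continuousOn
    (hright.surjOn hhm |>.image_eq_of_mapsTo hfm))
  exact (Nat.lt_succ_self _).not_ge this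

end LevelSets

/-! ### Application to potentials and to functions on open sets. -/

section Conclusions

variable {κ : Type*} [Fintype κ]

theorem surfaceMeasure_eq (κ : Type*) [Fintype κ] : StructureIntegral.surfaceMeasure κ =
    Measure.euclideanHausdorffMeasure (finrank ℝ (EuclideanSpace ℝ κ) - 1) := by
  rw [finrank_euclideanSpace, StructureIntegral.surfaceMeasure]

theorem smoothLevelIntegral_of_eventually_subset {U : Set (EuclideanSpace ℝ κ)}
    {ψ g : EuclideanSpace ℝ κ → ℝ} {v₀ v₁ : ℝ} (hU : IsOpen U) (hψ : ContDiffOn ℝ ∞ ψ U)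
    (hg : ContDiffOn ℝ ∞ g {x ∈ U | fderiv ℝ ψ x ≠ 0})
    (hQ : ∀ w ∈ Ioo v₀ v₁, ∃ Q, IsCompact Q ∧ Q ⊆ {x ∈ U | fderiv ℝ ψ x ≠ 0} ∧
      ∀ᶠ v in 𝓝 w, StructureIntegral.levelSet U ψ v ⊆ Q) :
    StructureIntegral.SmoothLevelIntegral U ψ g v₀ v₁ := by
  unfold StructureIntegral.SmoothLevelIntegral
  rw [surfaceMeasure_eq]
  exact contDiffOn_setIntegral_levelSet hU hψ hg hQ

theorem smoothLevelIntegral_of_morseOn {U : Set (EuclideanSpace ℝ κ)}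
    {ψ g : EuclideanSpace ℝ κ → ℝ} {v₀ v₁ : ℝ} (hκ : 2 ≤ Fintype.card κ) (hU : IsOpen U)
    (hψ : ContDiffOn ℝ ∞ ψ U)
    (hM : StructureIntegral.MorseOn ψ {x ∈ U | v₀ ≤ ψ x ∧ ψ x ≤ v₁})
    (hc : ∀ v ∈ Icc v₀ v₁, IsCompact (StructureIntegral.levelSet U ψ v))
    (hdiff : ∀ v ∈ Icc v₀ v₁, ∀ v' ∈ Icc v₀ v₁, StructureIntegral.DiffeomorphicSubsets
      (StructureIntegral.levelSet U ψ v) (StructureIntegral.levelSet U ψ v'))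
    (hg : ContDiffOn ℝ ∞ g {x ∈ U | fderiv ℝ ψ x ≠ 0}) :
    StructureIntegral.SmoothLevelIntegral U ψ g v₀ v₁ := by
  refine smoothLevelIntegral_of_eventually_subset hU hψ hg fun w hw => ?_
  refine exists_isCompact_eventually_levelSet_subset hU hψ (hc w (Ioo_subset_Icc_self hw))
    (fderiv_ne_zero_of_morseOn_of_diffeomorphicSubsets (by rwa [finrank_euclideanSpace])
      hU hψ hM hdiff hw) ?_
  filter_upwards [isOpen_Ioo.mem_nhds hw] with v hv
  exact hdiff w (Ioo_subset_Icc_self hw) v (Ioo_subset_Icc_self hv)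

theorem fderiv_ne_zero_iff_gradient_ne_zero {ψ : EuclideanSpace ℝ κ → ℝ}
    {x : EuclideanSpace ℝ κ} : fderiv ℝ ψ x ≠ 0 ↔ gradient ψ x ≠ 0 := by
  simp [gradient]

theorem contDiffOn_one_div_norm_gradient {U : Set (EuclideanSpace ℝ κ)}
    {ψ : EuclideanSpace ℝ κ → ℝ} (hU : IsOpen U) (hψ : ContDiffOn ℝ ∞ ψ U) :
    ContDiffOn ℝ ∞ (fun x => 1 / ‖gradient ψ x‖) {x ∈ U | fderiv ℝ ψ x ≠ 0} := by
  set b := stdOrthonormalBasis ℝ (EuclideanSpace ℝ κ)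
  have hsq : ∀ x, ‖gradient ψ x‖ ^ 2 = ∑ i, fderiv ℝ ψ x (b i) ^ 2 := fun x => by
    rw [← b.sum_sq_norm_inner_left (gradient ψ x)]
    refine Finset.sum_congr rfl fun i _ => ?_
    rw [Real.norm_eq_abs, sq_abs, gradient, InnerProductSpace.toDual_symm_apply]
  have hnorm : ∀ x, ‖gradient ψ x‖ = √(∑ i, fderiv ℝ ψ x (b i) ^ 2) := fun x => by
    rw [← hsq, Real.sqrt_sq (norm_nonneg _)]
  have hd : ContDiffOn ℝ ∞ (fderiv ℝ ψ) U := hψ.fderiv_of_isOpen hU (by simp)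
  have hn : ContDiffOn ℝ ∞ (fun x => ‖gradient ψ x‖) {x ∈ U | fderiv ℝ ψ x ≠ 0} := by
    simp_rw [hnorm]
    refine ContDiffOn.sqrt ?_ fun x hx => ?_
    · exact (ContDiffOn.sum fun i _ => (hd.clm_apply contDiffOn_const).pow 2).mono fun x hx => hx.1
    · rw [← hsq]
      exact pow_ne_zero 2 (norm_ne_zero_iff.2 (fderiv_ne_zero_iff_gradient_ne_zero.1 hx.2))
  exact contDiffOn_const.div hn fun x hx =>
    norm_ne_zero_iff.2 (fderiv_ne_zero_iff_gradient_ne_zero.1 hx.2)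

theorem smoothStructureIntegral_of_morseOn {V : EuclideanSpace ℝ κ → EReal} {v₀ v₁ : ℝ}
    (hκ : 2 ≤ Fintype.card κ) (hV : StructureIntegral.IsSmoothPotential V)
    (hb : Bornology.IsBounded {q | V q ≤ (v₁ : EReal)})
    (hM : StructureIntegral.MorseOn (fun q => (V q).toReal)
      {q | (v₀ : EReal) ≤ V q ∧ V q ≤ (v₁ : EReal)})
    (hdiff : ∀ v ∈ Icc v₀ v₁, ∀ v' ∈ Icc v₀ v₁, StructureIntegral.DiffeomorphicSubsets
      (StructureIntegral.equipotential V v) (StructureIntegral.equipotential V v')) :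
    StructureIntegral.SmoothStructureIntegral V v₀ v₁ := by
  set U : Set (EuclideanSpace ℝ κ) := {q | V q ≠ ⊤}
  set ψ : EuclideanSpace ℝ κ → ℝ := fun q => (V q).toReal
  have hU : IsOpen U := isOpen_ne.preimage hV.continuous
  have hcoe : ∀ q ∈ U, ((ψ q : ℝ) : EReal) = V q := fun q hq =>
    EReal.coe_toReal hq (hV.ne_bot q)
  have hlevel : ∀ v, StructureIntegral.equipotential V v = StructureIntegral.levelSet U ψ v := by
    intro v
    ext q
    constructor
    · intro hq
      have hq : V q = v := hq
      exact ⟨by simp [U, hq], by simp [ψ, hq]⟩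
    · rintro ⟨hq, hqv⟩
      exact (hcoe q hq).symm.trans (by rw [hqv])
  have hc : ∀ v ∈ Icc v₀ v₁, IsCompact (StructureIntegral.levelSet U ψ v) := by
    intro v hv
    rw [← hlevel]
    -- Continuity of `V` into `EReal` makes the level closed in the whole space, so it cannot
    -- accumulate where `V` becomes infinite.
    refine Metric.isCompact_of_isClosed_isBounded
      (isClosed_singleton.preimage hV.continuous) (hb.subset fun q hq => ?_)
    have hq : V q = v := hq
    change V q ≤ v₁
    rw [hq]
    exact EReal.coe_le_coe_iff.2 hv.2
  have hM' : StructureIntegral.MorseOn ψ {x ∈ U | v₀ ≤ ψ x ∧ ψ x ≤ v₁} := fun x hx =>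
    hM x ⟨by rw [← hcoe x hx.1]; exact EReal.coe_le_coe_iff.2 hx.2.1,
      by rw [← hcoe x hx.1]; exact EReal.coe_le_coe_iff.2 hx.2.2⟩
  simp only [hlevel] at hdiff
  have h := smoothLevelIntegral_of_morseOn hκ hU hV.contDiffOn hM' hc hdiff
    (contDiffOn_one_div_norm_gradient hU hV.contDiffOn)
  unfold StructureIntegral.SmoothStructureIntegral StructureIntegral.structureIntegral
  simp only [hlevel]
  exact h

theorem isBounded_setOf_forall_position_mem {ι : Type*} [Fintype ι] {D : ℕ}
    {K : Set (EuclideanSpace ℝ (Fin D))} (hK : Bornology.IsBounded K) :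
    Bornology.IsBounded {q : EuclideanSpace ℝ (ι × Fin D) |
      ∀ i, StructureIntegral.position q i ∈ K} := by
  obtain ⟨R, hR⟩ := hK.exists_norm_le
  refine isBounded_iff_forall_norm_le.2 ⟨√(∑ _p : ι × Fin D, R ^ 2), fun q hq => ?_⟩
  rw [EuclideanSpace.norm_eq]
  refine Real.sqrt_le_sqrt (Finset.sum_le_sum fun p _ => ?_)
  have h1 : ‖q p‖ ≤ ‖StructureIntegral.position q p.1‖ :=
    PiLp.norm_apply_le (StructureIntegral.position q p.1) p.2
  exact pow_le_pow_left₀ (norm_nonneg _) (h1.trans (hR _ (hq p.1))) 2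

theorem EReal.finsetSum_ne_bot {α : Type*} {s : Finset α} {f : α → EReal}
    (hf : ∀ i ∈ s, f i ≠ ⊥) : ∑ i ∈ s, f i ≠ ⊥ :=
  Finset.sum_induction f (· ≠ ⊥) (fun _ _ ha hb h => (EReal.add_eq_bot_iff.1 h).elim ha hb)
    EReal.zero_ne_bot hf

theorem EReal.finsetSum_eq_top {α : Type*} {s : Finset α} {f : α → EReal}
    (hf : ∀ i ∈ s, f i ≠ ⊥) {i : α} (hi : i ∈ s) (hfi : f i = ⊤) : ∑ i ∈ s, f i = ⊤ := by
  classical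
  rw [← Finset.add_sum_erase s f hi, hfi]
  exact EReal.top_add_of_ne_bot
    (EReal.finsetSum_ne_bot fun j hj => hf j (Finset.mem_of_mem_erase hj))

/-- A particle outside `Λ` makes the barrier sum `⊤`. Only a pair sum equal to `⊥` could absorb
this, and then the total would be `⊥`, which is excluded. -/
theorem position_mem_of_fluidPotential_ne_top {n d : ℕ} {Ψ : ℝ → EReal}
    {Λ Λ' : Set (EuclideanSpace ℝ (Fin d))} {U : EuclideanSpace ℝ (Fin d) → EReal}
    (hU : StructureIntegral.IsSmoothBarrier Λ Λ' U) {q : EuclideanSpace ℝ (Fin n × Fin d)}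
    (hbot : StructureIntegral.fluidPotential n d Ψ U q ≠ ⊥)
    (htop : StructureIntegral.fluidPotential n d Ψ U q ≠ ⊤) (i : Fin n) :
    StructureIntegral.position q i ∈ Λ := by
  by_contra hi
  refine htop ?_
  unfold StructureIntegral.fluidPotential at hbot ⊢
  rw [EReal.finsetSum_eq_top (fun j _ => hU.smooth.ne_bot _) (Finset.mem_univ i)
    (hU.eq_top _ hi)]
  exact EReal.add_top_of_ne_bot fun h => hbot (by rw [h, EReal.bot_add])

end Conclusions

end

theorem lemma2 :
    -- fluid case
    (∀ (n d : ℕ) (Ψ : ℝ → EReal) (Λ Λ' : Set (EuclideanSpace ℝ (Fin d)))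
      (U : EuclideanSpace ℝ (Fin d) → EReal) (v₀ v₁ : ℝ),
      2 ≤ n * d →
      StructureIntegral.IsSmoothBarrier Λ Λ' U →
      StructureIntegral.IsSmoothPotential (StructureIntegral.fluidPotential n d Ψ U) →
      StructureIntegral.MorseOn
        (fun q => (StructureIntegral.fluidPotential n d Ψ U q).toReal)
        {q | (v₀ : EReal) ≤ StructureIntegral.fluidPotential n d Ψ U q ∧
          StructureIntegral.fluidPotential n d Ψ U q ≤ (v₁ : EReal)} →
      (∀ v ∈ Set.Icc v₀ v₁, ∀ v' ∈ Set.Icc v₀ v₁,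
        StructureIntegral.DiffeomorphicSubsets
          (StructureIntegral.equipotential (StructureIntegral.fluidPotential n d Ψ U) v)
          (StructureIntegral.equipotential (StructureIntegral.fluidPotential n d Ψ U) v')) →
      StructureIntegral.SmoothStructureIntegral
        (StructureIntegral.fluidPotential n d Ψ U) v₀ v₁) ∧
    -- lattice case
    (∀ (d : ℕ) (I : Finset (Fin d → ℕ)) (D : ℕ) (C : (Fin d → ℕ) → (Fin d → ℕ) → ℝ)
      (Ψ : ℝ → EReal) (Φ : EuclideanSpace ℝ (Fin D) → EReal) (v₀ v₁ : ℝ),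
      2 ≤ I.card * D →
      StructureIntegral.IsSmoothPotential (StructureIntegral.latticePotential I D C Ψ Φ) →
      StructureIntegral.ConfinesSites (StructureIntegral.latticePotential I D C Ψ Φ) →
      StructureIntegral.MorseOn
        (fun q => (StructureIntegral.latticePotential I D C Ψ Φ q).toReal)
        {q | (v₀ : EReal) ≤ StructureIntegral.latticePotential I D C Ψ Φ q ∧
          StructureIntegral.latticePotential I D C Ψ Φ q ≤ (v₁ : EReal)} →
      (∀ v ∈ Set.Icc v₀ v₁, ∀ v' ∈ Set.Icc v₀ v₁,
        StructureIntegral.DiffeomorphicSubsets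
          (StructureIntegral.equipotential (StructureIntegral.latticePotential I D C Ψ Φ) v)
          (StructureIntegral.equipotential (StructureIntegral.latticePotential I D C Ψ Φ) v')) →
      StructureIntegral.SmoothStructureIntegral
        (StructureIntegral.latticePotential I D C Ψ Φ) v₀ v₁) ∧
    -- Morse functions on bounded open sets, smooth integrands
    (∀ (N : ℕ) (U : Set (EuclideanSpace ℝ (Fin N))) (ψ : EuclideanSpace ℝ (Fin N) → ℝ)
      (v₀ v₁ : ℝ),
      2 ≤ N → IsOpen U → Bornology.IsBounded U → ContDiffOn ℝ ∞ ψ U →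
      StructureIntegral.MorseOn ψ {x ∈ U | v₀ ≤ ψ x ∧ ψ x ≤ v₁} →
      (∀ v ∈ Set.Icc v₀ v₁, IsCompact (StructureIntegral.levelSet U ψ v)) →
      (∀ v ∈ Set.Icc v₀ v₁, ∀ v' ∈ Set.Icc v₀ v₁,
        StructureIntegral.DiffeomorphicSubsets
          (StructureIntegral.levelSet U ψ v) (StructureIntegral.levelSet U ψ v')) →
      ∀ g : EuclideanSpace ℝ (Fin N) → ℝ, ContDiffOn ℝ ∞ g U →
        StructureIntegral.SmoothLevelIntegral U ψ g v₀ v₁) ∧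
    -- gradient bounded below on the region between the levels, smooth integrands
    (∀ (N : ℕ) (U : Set (EuclideanSpace ℝ (Fin N))) (ψ : EuclideanSpace ℝ (Fin N) → ℝ)
      (v₀ v₁ c : ℝ),
      1 ≤ N → IsOpen U → Bornology.IsBounded U → ContDiffOn ℝ ∞ ψ U →
      (∀ a b : ℝ, v₀ < a → b < v₁ → IsCompact {x ∈ U | a ≤ ψ x ∧ ψ x ≤ b}) →
      0 < c → (∀ x ∈ U, v₀ < ψ x → ψ x < v₁ → c ≤ ‖gradient ψ x‖) →
      ∀ g : EuclideanSpace ℝ (Fin N) → ℝ, ContDiffOn ℝ ∞ g U →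
        StructureIntegral.SmoothLevelIntegral U ψ g v₀ v₁) := by
  refine ⟨?_, ?_, ?_, ?_⟩
  · intro n d Ψ Λ Λ' U v₀ v₁ hN hU hV hM hdiff
    refine smoothStructureIntegral_of_morseOn (by simpa using hN) hV ?_ hM hdiff
    refine (isBounded_setOf_forall_position_mem hU.isCompact.isBounded).subset fun q hq i => ?_
    exact position_mem_of_fluidPotential_ne_top hU (hV.ne_bot q)
      (ne_top_of_le_ne_top (EReal.coe_ne_top v₁) hq) i
  · intro d I D C Ψ Φ v₀ v₁ hN hV hconf hM hdiff
    refine smoothStructureIntegral_of_morseOn (by simpa using hN) hV ?_ hM hdiff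
    obtain ⟨K, hK, hqK⟩ := hconf v₁
    exact (isBounded_setOf_forall_position_mem hK.isBounded).subset fun q hq i => hqK q hq i
  · intro N U ψ v₀ v₁ hN hU _ hψ hM hc hdiff g hg
    exact smoothLevelIntegral_of_morseOn (by simpa using hN) hU hψ hM hc hdiff
      (hg.mono fun x hx => hx.1)
  · intro N U ψ v₀ v₁ c _ hU _ hψ hc hc0 hgrad g hg
    refine smoothLevelIntegral_of_eventually_subset hU hψ (hg.mono fun x hx => hx.1)
      fun w hw => ?_
    obtain ⟨a, ha, haw⟩ := exists_between hw.1
    obtain ⟨b, hwb, hb⟩ := exists_between hw.2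
    -- The trapping compact set is the slab `a ≤ ψ ≤ b` with `v₀ < a < w < b < v₁`; the gradient
    -- bound makes it regular.
    refine ⟨_, hc a b ha hb, fun x hx => ⟨hx.1, ?_⟩, ?_⟩
    · have := hgrad x hx.1 (ha.trans_le hx.2.1) (hx.2.2.trans_lt hb)
      exact fderiv_ne_zero_iff_gradient_ne_zero.2 (norm_pos_iff.1 (hc0.trans_le this))
    · filter_upwards [isOpen_Ioo.mem_nhds (⟨haw, hwb⟩ : w ∈ Ioo a b)] with v hv x hx
      refine ⟨hx.1, ?_, ?_⟩
      · rw [hx.2]; exact hv.1.le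
      · rw [hx.2]; exact hv.2.le
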